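/- Let $p=-i\,\frac{d}{dx}$ on $\mathbb R$, and for a function $K$ let $K(p)$ denote the Fourier multiplier with symbol $K(k)$; functions $K(p)\varphi$ below are identified with their continuous representatives. Put $g(x)=2x-\sin 2x$ and $h(x)=\frac{1}{1+g(x)^2}$. For $m>0$ and $c>0$ define $$f_c=\frac{1}{2mc}\Big(\sqrt{(p+1)^2+m^2c^2}+\sqrt{(p-1)^2+m^2c^2}\Big)h,\qquad u_c(x)=f_c(x)\sin x,$$ $$\lambda_c=c\big(\sqrt{1+m^2c^2}-mc\big),\qquad V_c(x)=\lambda_c-c\,\frac{\big((\sqrt{p^2+m^2c^2}-mc)\,u_c\big)(x)}{u_c(x)},$$ where at a zero of $u_c$ the value of $V_c$ is the limit of the quotient formula. On $\mathbb R^3$ put $$v_c(x)=\frac{u_c(|x|)}{\sqrt{4\pi}\,|x|},\qquad W_c(x)=V_c(|x|),$$ with $v_c$ extended continuously to $x=0$, and let $$u_{\rm NW}(x)=\frac{\sin|x|}{|x|\,(1+g(|x|)^2)},\qquad u_{\rm NW}(0)=1,$$ $$V_{\rm NW}(x)=-32\,\frac{\sin|x|\,\big(g(|x|)^3\cos|x|-3g(|x|)^2\sin^3|x|+g(|x|)\cos|x|+\sin^3|x|\big)}{(1+g(|x|)^2)^2}.$$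 Then for every fixed $m>0$: 1. $\displaystyle\lim_{c\to\infty}\lambda_c=\frac1{2m}$. 2. The functions $v_c$ ($c>0$) and $u_{\rm NW}$ are $C^2$ on $\mathbb R^3$, and $\displaystyle\lim_{c\to\infty}v_c=\frac{1}{\sqrt{4\pi}}\,u_{\rm NW}$ in $C^2(\mathbb R^3)$, that is, uniformly on $\mathbb R^3$ together with all derivatives of order at most two. 3. For every $x\in\mathbb R^3$: for all sufficiently large $c$ (depending on $x$), $u_c$ has no zero in a punctured neighbourhood of $|x|$ and the formula for $V_c$ has limit $W_c(x)$ at $|x|$ (so that $W_c(x)$ is well defined also when $u_c(|x|)=0$), and $$\lim_{c\to\infty}W_c(x)=\frac{1}{2m}\,V_{\rm NW}(x).$$ -/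

import Mathlib

open Filter Topology
open scoped FourierTransform

noncomputable section

namespace NeumannWigner

/-- The function `K(p) φ` on the real line, where `p = -i d/dx`. In the normalization
`𝓕 φ ξ = ∫ exp (-2πi ξ y) φ y dy` the operator `p` is multiplication by `2πξ`, so `K(p)` is
multiplication by `K (2πξ)`. For `φ` and `ξ ↦ K (2πξ) 𝓕 φ ξ` integrable this is the continuous
representative of the function given by the `L²` functional calculus. -/
def multiplier (K : ℝ → ℝ) (φ : ℝ → ℂ) : ℝ → ℂ :=
  𝓕⁻ (fun ξ : ℝ => (K (2 * Real.pi * ξ) : ℂ) * 𝓕 φ ξ)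

/-- `g(x) = 2x - sin 2x`. -/
def g (x : ℝ) : ℝ := 2 * x - Real.sin (2 * x)

/-- `h = 1 / (1 + g²)`. -/
def h (x : ℝ) : ℝ := 1 / (1 + g x ^ 2)

/-- `f_c = (1/(2mc)) (√((p+1)² + m²c²) + √((p-1)² + m²c²)) h`. -/
def f (m c : ℝ) (x : ℝ) : ℂ :=
  ((1 / (2 * m * c) : ℝ) : ℂ) *
    multiplier (fun k => √((k + 1) ^ 2 + m ^ 2 * c ^ 2) + √((k - 1) ^ 2 + m ^ 2 * c ^ 2))
      (fun y => (h y : ℂ)) x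

/-- `u_c(x) = f_c(x) sin x`. -/
def u (m c : ℝ) (x : ℝ) : ℂ := f m c x * (Real.sin x : ℂ)

/-- `λ_c = c (√(1 + m²c²) - mc)`. -/
def eigenvalue (m c : ℝ) : ℝ := c * (√(1 + m ^ 2 * c ^ 2) - m * c)

/-- `λ_c - c ((√(p² + m²c²) - mc) u_c)(x) / u_c(x)`, meaningful where `u_c(x) ≠ 0`. -/
def potentialQuotient (m c : ℝ) (x : ℝ) : ℂ :=
  (eigenvalue m c : ℂ) -
    (c : ℂ) * multiplier (fun k => √(k ^ 2 + m ^ 2 * c ^ 2) - m * c) (u m c) x / u m c x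

open Classical in
/-- The potential `V_c`: the quotient above where `u_c ≠ 0`, and its limit at a zero of `u_c`. -/
def V (m c : ℝ) (x : ℝ) : ℂ :=
  if u m c x ≠ 0 then potentialQuotient m c x
  else limUnder (𝓝[≠] x) (potentialQuotient m c)

open Classical in
/-- `v_c(x) = u_c(|x|) / (√(4π) |x|)` on `ℝ³`; the value at the origin is the continuous one
(recall that `u_c(0) = 0`). -/
def v (m c : ℝ) (x : EuclideanSpace ℝ (Fin 3)) : ℂ :=
  if x = 0 then deriv (u m c) 0 / (√(4 * Real.pi) : ℂ)
  else u m c ‖x‖ / ((√(4 * Real.pi) * ‖x‖ : ℝ) : ℂ)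

/-- `W_c(x) = V_c(|x|)` on `ℝ³`. -/
def W (m c : ℝ) (x : EuclideanSpace ℝ (Fin 3)) : ℂ := V m c ‖x‖

/-- `u_NW(x) = sin |x| / (|x| (1 + g(|x|)²))`, with value `1` at the origin. -/
def uNW (x : EuclideanSpace ℝ (Fin 3)) : ℝ := Real.sinc ‖x‖ / (1 + g ‖x‖ ^ 2)

/-- The classical von Neumann–Wigner potential. -/
def VNW (x : EuclideanSpace ℝ (Fin 3)) : ℝ :=
  -32 * (Real.sin ‖x‖ *
    (g ‖x‖ ^ 3 * Real.cos ‖x‖ - 3 * g ‖x‖ ^ 2 * Real.sin ‖x‖ ^ 3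
      + g ‖x‖ * Real.cos ‖x‖ + Real.sin ‖x‖ ^ 3)) / (1 + g ‖x‖ ^ 2) ^ 2

/-- Convergence in `C²(ℝ³)` with its uniform norm, as the real parameter tends to infinity: the
functions are `C²`, and they converge uniformly on `ℝ³` together with their derivatives of order
at most two. -/
def TendstoUniformlyC2 (w : ℝ → EuclideanSpace ℝ (Fin 3) → ℂ)
    (w₀ : EuclideanSpace ℝ (Fin 3) → ℂ) : Prop :=
  (∀ c : ℝ, 0 < c → ContDiff ℝ 2 (w c)) ∧ ContDiff ℝ 2 w₀ ∧
    ∀ j : ℕ, j ≤ 2 →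
      TendstoUniformly (fun c x => iteratedFDeriv ℝ j (w c) x) (iteratedFDeriv ℝ j w₀) atTop

end NeumannWigner

end

noncomputable section

namespace NeumannWigner

open MeasureTheory

/-! Put `μ = m c`, `S± = √((k ± 1)² + μ²)`, `K = S₊ + S₋` and `M = √(1 + μ²)`, so that `f_c = K(p) h
/ (2μ)`. Writing `sin` through `e^{±ix}` turns `√(p² + μ²) - μ` acting on `f_c sin` into the symbols
`(S± - μ) K` acting on `h`. Since `S±² = (k ± 1)² + μ²`, these equal `(M - μ) K + (S₊ - M)(S₋ - M) +
k² ± 2k`. The first term produces the eigenvalue, `k²` gives `-h''`, the odd part `±2k` gives `h'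
cos`, and the product is a remainder (`multiplier_u`). Because `h'` carries a factor `sin²`, the
division by `sin` is harmless, and `V_c` equals `(G - 16 g sin cos h²) / (2m f_c)` wherever `f_c ≠
0`, including the zeros of `sin` (`V_eq`).

All derivatives of `h` are integrable, so its Fourier transform decays rapidly and a polynomially
weighted bound on a symbol bounds the multiplier uniformly in `x` (`exists_multiplier_bound`). Both
`K / (2μ) - 1` and the remainder symbol are `O(μ⁻²)` in this sense. Hence `f_c → h` uniformly with
two derivatives and `G → h''`. As `h > 0`, `f_c` is nonzero at a given point for large `c`, and
`V_c` tends to `(h'' + 2 h' cot) / (2m h)`, with `h' cot` extended across the zeros of `sin`.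

On `ℝ³`, `v_c` is the even smooth function `f_c sinc / √(4π)` of `|x|`. For such functions the
derivatives up to order two on `ℝ³` are bounded by those on the line, which gives the `C²`
convergence. -/

/-! ### Integrals over dilations and Hadamard's lemma. -/

lemma hasDerivAt_integral_dilation (n : ℕ) {Φ Φ' : ℝ → ℂ} (hΦ : ∀ x, HasDerivAt Φ (Φ' x) x)
    (hΦ' : Continuous Φ') (x : ℝ) :
    HasDerivAt (fun r : ℝ => ∫ t in (0 : ℝ)..1, (t : ℂ) ^ n * Φ (t * r))
      (∫ t in (0 : ℝ)..1, (t : ℂ) ^ (n + 1) * Φ' (t * x)) x := by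
  have hc : Continuous Φ := continuous_iff_continuousAt.2 fun y => (hΦ y).continuousAt
  obtain ⟨C, hC⟩ := (isCompact_Icc (a := -(|x| + 1)) (b := |x| + 1)).exists_bound_of_continuousOn
    hΦ'.continuousOn
  refine (intervalIntegral.hasDerivAt_integral_of_dominated_loc_of_deriv_le
    (s := Metric.ball x 1) (bound := fun _ => C)
    (F := fun r t => (t : ℂ) ^ n * Φ (t * r)) (F' := fun r t => (t : ℂ) ^ (n + 1) * Φ' (t * r))
    (Metric.ball_mem_nhds x one_pos) ?_ ?_ ?_ ?_ ?_ ?_).2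
  · exact Eventually.of_forall fun r => (by fun_prop : Continuous _).aestronglyMeasurable
  · exact (by fun_prop : Continuous _).intervalIntegrable _ _
  · exact (by fun_prop : Continuous _).aestronglyMeasurable
  · refine ae_of_all _ fun t ht r hr => ?_
    rw [Set.uIoc_of_le zero_le_one] at ht
    have h1 : |t| ≤ 1 := by rw [abs_of_pos ht.1]; exact ht.2
    have h2 : |r| ≤ |x| + 1 := by
      have := abs_sub_abs_le_abs_sub r x
      rw [Metric.mem_ball, Real.dist_eq] at hr
      linarith
    have h3 : |t * r| ≤ |x| + 1 := by
      rw [abs_mul]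
      nlinarith [abs_nonneg t, abs_nonneg r]
    have h4 := hC (t * r) (abs_le.1 h3)
    rw [norm_mul, norm_pow, Complex.norm_real, Real.norm_eq_abs]
    calc |t| ^ (n + 1) * ‖Φ' (t * r)‖ ≤ 1 * ‖Φ' (t * r)‖ := by
          gcongr
          exact pow_le_one₀ (abs_nonneg _) h1
      _ ≤ C := by rw [one_mul]; exact h4
  · exact intervalIntegrable_const
  · refine ae_of_all _ fun t _ r _ => ?_
    have h1 : HasDerivAt (fun r : ℝ => Φ (t * r)) (t • Φ' (t * r)) r :=
      (hΦ (t * r)).scomp r (by simpa using (hasDerivAt_id r).const_mul t)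
    refine (h1.const_mul ((t : ℂ) ^ n)).congr_deriv ?_
    rw [Complex.real_smul]
    ring

lemma continuous_integral_dilation (n : ℕ) {Φ : ℝ → ℂ} (hΦ : Continuous Φ) :
    Continuous (fun r : ℝ => ∫ t in (0 : ℝ)..1, (t : ℂ) ^ n * Φ (t * r)) := by
  apply intervalIntegral.continuous_parametric_intervalIntegral_of_continuous'
  simp only [Function.uncurry_def]
  fun_prop

/-- Hadamard's lemma for a function vanishing at the origin. -/
lemma eq_mul_integral_deriv {Φ Φ' : ℝ → ℂ} (hΦ : ∀ x, HasDerivAt Φ (Φ' x) x)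
    (hΦ' : Continuous Φ') (h0 : Φ 0 = 0) (r : ℝ) :
    Φ r = r * ∫ t in (0 : ℝ)..1, Φ' (t * r) := by
  have h1 : ∀ t : ℝ, HasDerivAt (fun t : ℝ => Φ (t * r)) (r * Φ' (t * r)) t := fun t => by
    have h3 : HasDerivAt (fun t : ℝ => Φ (t * r)) (r • Φ' (t * r)) t :=
      (hΦ (t * r)).scomp t (by simpa using (hasDerivAt_id t).mul_const r)
    rwa [Complex.real_smul] at h3
  have h2 := intervalIntegral.integral_eq_sub_of_hasDerivAt (a := 0) (b := 1)
    (fun t _ => h1 t) ((by fun_prop : Continuous _).intervalIntegrable _ _)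
  rw [intervalIntegral.integral_const_mul] at h2
  rw [h2]
  simp [h0]

/-! ### Smoothness and derivative bounds for radial functions. -/

section Radial

variable {E : Type*} [NormedAddCommGroup E] [InnerProductSpace ℝ E]

variable (E) in
/-- The real inner product as a continuous bilinear map. -/
def innerBilin : E →L[ℝ] E →L[ℝ] ℝ := innerSL ℝ

@[simp] lemma innerBilin_apply (x : E) : innerBilin E x = innerSL ℝ x := rfl

/-- With `F' = r A` the gradient is `A(|x|) x`, which has no singularity. At the origin the norm is
not differentiable, but `F'(0) = 0` makes the increment `o(|y|)`. -/
lemma hasFDerivAt_comp_norm {F A : ℝ → ℂ} (hF : ∀ r, HasDerivAt F (r * A r) r) (x : E) :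
    HasFDerivAt (fun y : E => F ‖y‖) ((innerSL ℝ x).smulRight (A ‖x‖)) x := by
  rcases eq_or_ne x 0 with rfl | hx
  · have h0 : HasDerivAt F 0 0 := by simpa using hF 0
    rw [hasDerivAt_iff_isLittleO_nhds_zero] at h0
    rw [hasFDerivAt_iff_isLittleO_nhds_zero]
    have h1 := h0.comp_tendsto (tendsto_norm_zero (E := E))
    refine (h1.congr ?_ ?_ |>.trans_isBigO (Asymptotics.isBigO_refl _ _).norm_left)
    · intro y; simp
    · intro y; rfl
  · have h1 := (hasStrictFDerivAt_norm_sq x).hasFDerivAt.sqrt (by simpa using hx)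
    simp only [Real.sqrt_sq (norm_nonneg _)] at h1
    have h2 := (hF ‖x‖).hasFDerivAt.comp x h1
    refine h2.congr_fderiv ?_
    ext y
    have : (‖x‖ : ℂ) ≠ 0 := by simpa using hx
    simp
    field_simp

lemma fderiv_comp_norm {F A : ℝ → ℂ} (hF : ∀ r, HasDerivAt F (r * A r) r) :
    fderiv ℝ (fun y : E => F ‖y‖) = fun x => (innerSL ℝ x).smulRight (A ‖x‖) :=
  funext fun x => (hasFDerivAt_comp_norm hF x).fderiv

lemma hasFDerivAt_fderiv_comp_norm {A B : ℝ → ℂ} (hA : ∀ r, HasDerivAt A (r * B r) r) (x : E) :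
    HasFDerivAt (fun x : E => (innerSL ℝ x).smulRight (A ‖x‖))
      ((ContinuousLinearMap.smulRightL ℝ E ℂ (innerSL ℝ x)).comp
          ((innerSL ℝ x).smulRight (B ‖x‖)) +
        ((ContinuousLinearMap.smulRightL ℝ E ℂ).flip (A ‖x‖)).comp
          (innerBilin E)) x := by
  have := (ContinuousLinearMap.smulRightL ℝ E ℂ).hasFDerivAt_of_bilinear
    (innerBilin E).hasFDerivAt (hasFDerivAt_comp_norm hA x)
  refine this.congr_fderiv ?_
  ext y z
  simp

lemma contDiff_two_comp_norm {F A B : ℝ → ℂ} (hF : ∀ r, HasDerivAt F (r * A r) r)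
    (hA : ∀ r, HasDerivAt A (r * B r) r) (hB : Continuous B) :
    ContDiff ℝ 2 (fun y : E => F ‖y‖) := by
  have hAc : Continuous A := continuous_iff_continuousAt.2 fun y => (hA y).continuousAt
  rw [show (2 : WithTop ℕ∞) = 1 + 1 by norm_num, contDiff_succ_iff_fderiv, fderiv_comp_norm hF]
  refine ⟨fun x => (hasFDerivAt_comp_norm hF x).differentiableAt, by simp, ?_⟩
  rw [contDiff_one_iff_fderiv]
  refine ⟨fun x => (hasFDerivAt_fderiv_comp_norm hA x).differentiableAt, ?_⟩
  rw [funext fun x : E => (hasFDerivAt_fderiv_comp_norm hA x).fderiv]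
  refine Continuous.add ?_ ?_
  · refine Continuous.clm_comp (by fun_prop) ?_
    change Continuous fun x : E => ContinuousLinearMap.smulRightL ℝ E ℂ (innerSL ℝ x) (B ‖x‖)
    fun_prop
  · fun_prop

/-- The Hessian is `B(|x|) x ⊗ x + A(|x|) I`, so its norm is at most `r² |B| + |A| ≤ 2ε + ε`. -/
lemma norm_iteratedFDeriv_comp_norm_le {F A B : ℝ → ℂ} (hF : ∀ r, HasDerivAt F (r * A r) r)
    (hA : ∀ r, HasDerivAt A (r * B r) r) {ε : ℝ} (h0 : ∀ r, ‖F r‖ ≤ ε)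
    (h1 : ∀ r, ‖r * A r‖ ≤ ε) (h2 : ∀ r, ‖A r‖ ≤ ε) (h3 : ∀ r, ‖r * (r * B r)‖ ≤ 2 * ε)
    {j : ℕ} (hj : j ≤ 2) (x : E) :
    ‖iteratedFDeriv ℝ j (fun y : E => F ‖y‖) x‖ ≤ 3 * ε := by
  have hε : 0 ≤ ε := (norm_nonneg _).trans (h0 0)
  interval_cases j
  · rw [norm_iteratedFDeriv_zero]
    linarith [h0 ‖x‖]
  · rw [norm_iteratedFDeriv_one, fderiv_comp_norm hF]
    have := h1 ‖x‖
    simp only [norm_mul, Complex.norm_real, norm_norm] at this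
    simp only [ContinuousLinearMap.norm_smulRight_apply, innerSL_apply_norm]
    linarith
  · rw [← norm_iteratedFDeriv_fderiv, norm_iteratedFDeriv_one, fderiv_comp_norm hF,
      (hasFDerivAt_fderiv_comp_norm hA x).fderiv]
    refine ContinuousLinearMap.opNorm_le_bound _ (by positivity) fun y =>
      ContinuousLinearMap.opNorm_le_bound _ (by positivity) fun z => ?_
    have h4 := h2 ‖x‖
    have h5 := h3 ‖x‖
    simp only [norm_mul, Complex.norm_real, norm_norm] at h5
    have h6 := abs_real_inner_le_norm x y
    have h7 := abs_real_inner_le_norm x z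
    have h8 := abs_real_inner_le_norm y z
    have e : ((((ContinuousLinearMap.smulRightL ℝ E ℂ (innerSL ℝ x)).comp
          ((innerSL ℝ x).smulRight (B ‖x‖)) +
        ((ContinuousLinearMap.smulRightL ℝ E ℂ).flip (A ‖x‖)).comp
          (innerBilin E)) y) z) =
        (inner ℝ x z : ℂ) * ((inner ℝ x y : ℂ) * B ‖x‖) + (inner ℝ y z : ℂ) * A ‖x‖ := by
      simp
    rw [e]
    calc _ ≤ ‖(inner ℝ x z : ℂ) * ((inner ℝ x y : ℂ) * B ‖x‖)‖ + ‖(inner ℝ y z : ℂ) * A ‖x‖‖ :=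
          norm_add_le _ _
      _ = |inner ℝ x z| * (|inner ℝ x y| * ‖B ‖x‖‖) + |inner ℝ y z| * ‖A ‖x‖‖ := by
          simp
      _ ≤ (‖x‖ * ‖z‖) * ((‖x‖ * ‖y‖) * ‖B ‖x‖‖) + (‖y‖ * ‖z‖) * ‖A ‖x‖‖ := by gcongr
      _ = (‖x‖ * (‖x‖ * ‖B ‖x‖‖)) * (‖y‖ * ‖z‖) + ‖A ‖x‖‖ * (‖y‖ * ‖z‖) := by ring
      _ ≤ (2 * ε) * (‖y‖ * ‖z‖) + ε * (‖y‖ * ‖z‖) := by gcongr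
      _ = 3 * ε * ‖y‖ * ‖z‖ := by ring

lemma iteratedDeriv_zero_of_even {F : ℝ → ℂ} (he : ∀ r, F (-r) = F r) {n : ℕ} (hn : Odd n) :
    iteratedDeriv n F 0 = 0 := by
  have h1 := iteratedDeriv_comp_neg n F 0
  simp only [he, neg_zero, hn.neg_one_pow, neg_smul, one_smul] at h1
  exact self_eq_neg.1 h1

/-- An even smooth function `F` satisfies `F' = r A` and `A' = r B` with `B` continuous and `A`
controlled by `F''`. -/
lemma exists_radial_derivatives {F : ℝ → ℂ} (hF : ContDiff ℝ 4 F) (he : ∀ r, F (-r) = F r) :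
    ∃ A B : ℝ → ℂ, (∀ r, HasDerivAt F (r * A r) r) ∧ (∀ r, HasDerivAt A (r * B r) r) ∧
      Continuous B ∧
      ∀ ε : ℝ, (∀ i ≤ 2, ∀ r, ‖iteratedDeriv i F r‖ ≤ ε) →
        (∀ r, ‖r * A r‖ ≤ ε) ∧ (∀ r, ‖A r‖ ≤ ε) ∧ ∀ r, ‖r * (r * B r)‖ ≤ 2 * ε := by
  have hd : ∀ n < 4, ∀ r, HasDerivAt (iteratedDeriv n F) (iteratedDeriv (n + 1) F r) r := by
    intro n hn r
    rw [iteratedDeriv_succ]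
    exact (hF.differentiable_iteratedDeriv n (by exact_mod_cast hn) r).hasDerivAt
  have hc : ∀ n ≤ 4, Continuous (iteratedDeriv n F) := fun n hn =>
    hF.continuous_iteratedDeriv n (by exact_mod_cast hn)
  set A : ℝ → ℂ := fun r => ∫ t in (0 : ℝ)..1, (t : ℂ) ^ 0 * iteratedDeriv 2 F (t * r) with hA
  set E : ℝ → ℂ := fun r => ∫ t in (0 : ℝ)..1, (t : ℂ) ^ 0 * iteratedDeriv 4 F (t * r) with hE
  have hEc : Continuous E := continuous_integral_dilation 0 (hc 4 le_rfl)
  -- Differentiating `A` gives `∫ t F'''(t r) dt`. The odd function `F'''` equals `r E`, so `F'''(t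
  -- r) = t r E(t r)`, and the second factor `t` appears.
  set B : ℝ → ℂ := fun r => ∫ t in (0 : ℝ)..1, (t : ℂ) ^ 2 * E (t * r) with hB
  have h1 : ∀ r, iteratedDeriv 1 F r = r * A r := fun r => by
    simpa [hA] using eq_mul_integral_deriv (hd 1 (by norm_num)) (hc 2 (by norm_num))
      (iteratedDeriv_zero_of_even he odd_one) r
  have h3 : ∀ r, iteratedDeriv 3 F r = r * E r := fun r => by
    simpa [hE] using eq_mul_integral_deriv (hd 3 (by norm_num)) (hc 4 (by norm_num))
      (iteratedDeriv_zero_of_even he (by decide)) r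
  have hFA : ∀ r, HasDerivAt F (r * A r) r := fun r => by
    rw [← h1]
    simpa using hd 0 (by norm_num) r
  have hAB : ∀ r, HasDerivAt A (r * B r) r := fun r => by
    refine (hasDerivAt_integral_dilation 0 (hd 2 (by norm_num)) (hc 3 (by norm_num)) r).congr_deriv
      ?_
    rw [hB, ← intervalIntegral.integral_const_mul]
    refine intervalIntegral.integral_congr fun t _ => ?_
    simp only [h3]
    push_cast
    ring
  refine ⟨A, B, hFA, hAB, continuous_integral_dilation 2 hEc, fun ε hε => ?_⟩
  have hAε : ∀ r, ‖A r‖ ≤ ε := fun r => by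
    have := intervalIntegral.norm_integral_le_of_norm_le_const (a := 0) (b := 1) (C := ε)
      (f := fun t : ℝ => (t : ℂ) ^ 0 * iteratedDeriv 2 F (t * r))
      (fun t _ => by simpa using hε 2 le_rfl (t * r))
    simpa [hA] using this
  refine ⟨fun r => h1 r ▸ hε 1 (by norm_num) r, hAε, fun r => ?_⟩
  -- Differentiating `F' = r A` expresses `r² B` as `F'' - A`, so no derivative of `F` beyond the
  -- second enters the bound.
  have h2 : iteratedDeriv 2 F r = A r + r * (r * B r) := by
    have e1 := hd 1 (by norm_num) r
    rw [funext h1] at e1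
    have e2 := (hasDerivAt_id r).ofReal_comp.mul (hAB r)
    have := e1.unique e2
    simpa using this
  rw [show (r : ℂ) * (r * B r) = iteratedDeriv 2 F r - A r by rw [h2]; ring]
  linarith [norm_sub_le (iteratedDeriv 2 F r) (A r), hε 2 le_rfl r, hAε r]

lemma contDiff_two_comp_norm_of_even {F : ℝ → ℂ} (hF : ContDiff ℝ 4 F) (he : ∀ r, F (-r) = F r) :
    ContDiff ℝ 2 (fun y : E => F ‖y‖) := by
  obtain ⟨A, B, h1, h2, h3, -⟩ := exists_radial_derivatives hF he
  exact contDiff_two_comp_norm h1 h2 h3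

lemma norm_iteratedFDeriv_comp_norm_le_of_even {F : ℝ → ℂ} (hF : ContDiff ℝ 4 F)
    (he : ∀ r, F (-r) = F r) {ε : ℝ} (hε : ∀ i ≤ 2, ∀ r, ‖iteratedDeriv i F r‖ ≤ ε)
    {j : ℕ} (hj : j ≤ 2) (x : E) :
    ‖iteratedFDeriv ℝ j (fun y : E => F ‖y‖) x‖ ≤ 3 * ε := by
  obtain ⟨A, B, h1, h2, -, h4⟩ := exists_radial_derivatives hF he
  obtain ⟨h5, h6, h7⟩ := h4 ε hε
  exact norm_iteratedFDeriv_comp_norm_le h1 h2 (fun r => by simpa using hε 0 (by norm_num) r)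
    h5 h6 h7 hj x

end Radial

/-! ### The functions `g` and `h`: derivatives and integrability. -/

lemma hasDerivAt_g (x : ℝ) : HasDerivAt g (2 - 2 * Real.cos (2 * x)) x := by
  have h1 : HasDerivAt (fun x : ℝ => 2 * x) 2 x := by simpa using (hasDerivAt_id x).const_mul 2
  exact (h1.sub h1.sin).congr_deriv (by ring)

lemma g_neg (x : ℝ) : g (-x) = -g x := by
  simp only [g, mul_neg, Real.sin_neg]; ring

lemma h_neg (x : ℝ) : h (-x) = h x := by simp [h, g_neg]

lemma h_pos (x : ℝ) : 0 < h x := by unfold h; positivity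

lemma h_le_one (x : ℝ) : h x ≤ 1 := by
  unfold h
  rw [div_le_one (by positivity)]
  nlinarith [sq_nonneg (g x)]

lemma g_sq_mul_h (x : ℝ) : g x ^ 2 * h x = 1 - h x := by
  unfold h
  field_simp
  ring

lemma hasDerivAt_h (x : ℝ) :
    HasDerivAt h (h x * (-2 * (2 - 2 * Real.cos (2 * x)) * (g x * h x))) x := by
  have h1 := ((hasDerivAt_g x).pow 2).const_add 1
  have h2 := h1.inv (by simp only [Pi.pow_apply]; positivity)
  have e2 : h = fun y => (1 + (g ^ 2) y)⁻¹ := by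
    funext y; simp [h]
  rw [e2]
  refine h2.congr_deriv ?_
  simp
  field_simp

lemma h_le (x : ℝ) : h x ≤ 2 * (1 + x ^ 2)⁻¹ := by
  have h1 : 1 + x ^ 2 ≤ 2 * (1 + g x ^ 2) := by
    rcases le_total |x| 1 with hx | hx
    · have : x ^ 2 ≤ 1 := by rw [← sq_abs]; nlinarith [abs_nonneg x]
      nlinarith [sq_nonneg (g x)]
    · have h2 : |x| ≤ |g x| := by
        have h3 := abs_sub_abs_le_abs_sub (2 * x) (Real.sin (2 * x))
        have h4 := Real.abs_sin_le_one (2 * x)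
        rw [abs_mul, abs_two] at h3
        unfold g
        linarith
      have := sq_le_sq.2 h2
      nlinarith [sq_nonneg (g x)]
  unfold h
  rw [← div_eq_mul_inv, div_le_div_iff₀ (by positivity) (by positivity)]
  linarith

lemma integrable_h : MeasureTheory.Integrable h := by
  have hc : Continuous h := continuous_iff_continuousAt.2 fun y => (hasDerivAt_h y).continuousAt
  refine (integrable_inv_one_add_sq.const_mul 2).mono' hc.aestronglyMeasurable
    (MeasureTheory.ae_of_all _ fun x => ?_)
  rw [Real.norm_of_nonneg (h_pos x).le]
  exact h_le x

/-- An algebra of bounded functions, closed under differentiation, which contains `h`. -/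
def diffAlgebra : Subalgebra ℝ (ℝ → ℝ) :=
  Algebra.adjoin ℝ {h, fun x => g x * h x, fun x => Real.cos (2 * x), fun x => Real.sin (2 * x)}

lemma h_mem : h ∈ diffAlgebra := Algebra.subset_adjoin (by simp)
lemma gh_mem : (fun x => g x * h x) ∈ diffAlgebra := Algebra.subset_adjoin (by simp)
lemma cos_mem : (fun x => Real.cos (2 * x)) ∈ diffAlgebra := Algebra.subset_adjoin (by simp)
lemma sin_mem : (fun x => Real.sin (2 * x)) ∈ diffAlgebra := Algebra.subset_adjoin (by simp)

lemma const_mem (r : ℝ) : (fun _ => r) ∈ diffAlgebra := diffAlgebra.algebraMap_mem r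

lemma deriv_g_mem : (fun x => 2 - 2 * Real.cos (2 * x)) ∈ diffAlgebra :=
  sub_mem (const_mem 2) (mul_mem (const_mem 2) cos_mem)

/-- `g` is unbounded, so the generator is `g h` instead. The relation `g² h = 1 - h` turns `(g h)'`
into `g' h (2h - 1)`, which closes the algebra under differentiation. -/
lemma diffAlgebra_spec {a : ℝ → ℝ} (ha : a ∈ diffAlgebra) :
    (∃ M, ∀ x, |a x| ≤ M) ∧ ∃ a' ∈ diffAlgebra, ∀ x, HasDerivAt a (a' x) x := by
  induction ha using Algebra.adjoin_induction with
  | mem a ha =>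
    have hd : ∀ x : ℝ, HasDerivAt (fun x : ℝ => 2 * x) 2 x := fun x => by
      simpa using (hasDerivAt_id x).const_mul 2
    rcases ha with rfl | rfl | rfl | rfl
    · refine ⟨⟨1, fun x => ?_⟩, _, ?_, hasDerivAt_h⟩
      · rw [abs_of_pos (h_pos x)]; exact h_le_one x
      · exact mul_mem h_mem (mul_mem (mul_mem (const_mem (-2)) deriv_g_mem) gh_mem)
    · refine ⟨⟨1, fun x => ?_⟩, fun x => (2 - 2 * Real.cos (2 * x)) * h x * (2 * h x - 1), ?_,
        fun x => ?_⟩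
      · have h1 := g_sq_mul_h x
        have h2 := h_pos x
        have h3 := h_le_one x
        have : (g x * h x) ^ 2 ≤ 1 := by
          calc (g x * h x) ^ 2 = g x ^ 2 * h x * h x := by ring
            _ = (1 - h x) * h x := by rw [h1]
            _ ≤ 1 := by nlinarith
        exact abs_le_one_iff_mul_self_le_one.2 (by nlinarith)
      · exact mul_mem (mul_mem deriv_g_mem h_mem)
          (sub_mem (mul_mem (const_mem 2) h_mem) (const_mem 1))
      · refine ((hasDerivAt_g x).mul (hasDerivAt_h x)).congr_deriv ?_
        linear_combination (-2 * (2 - 2 * Real.cos (2 * x)) * h x) * g_sq_mul_h x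
    · exact ⟨⟨1, fun x => Real.abs_cos_le_one _⟩, _, mul_mem (const_mem (-2)) sin_mem,
        fun x => (hd x).cos.congr_deriv (by simp; ring)⟩
    · exact ⟨⟨1, fun x => Real.abs_sin_le_one _⟩, _, mul_mem (const_mem 2) cos_mem,
        fun x => (hd x).sin.congr_deriv (by simp; ring)⟩
  | algebraMap r =>
    exact ⟨⟨|r|, fun x => by simp⟩, _, const_mem 0, fun x => hasDerivAt_const x r⟩
  | add a b _ _ iha ihb =>
    obtain ⟨⟨M, hM⟩, a', ha', hda⟩ := iha
    obtain ⟨⟨N, hN⟩, b', hb', hdb⟩ := ihb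
    exact ⟨⟨M + N, fun x => (abs_add_le _ _).trans (add_le_add (hM x) (hN x))⟩, _,
      add_mem ha' hb', fun x => (hda x).add (hdb x)⟩
  | mul a b ha hb iha ihb =>
    obtain ⟨⟨M, hM⟩, a', ha', hda⟩ := iha
    obtain ⟨⟨N, hN⟩, b', hb', hdb⟩ := ihb
    refine ⟨⟨M * N, fun x => ?_⟩, _, add_mem (mul_mem ha' hb) (mul_mem ha hb'),
      fun x => (hda x).mul (hdb x)⟩
    rw [Pi.mul_apply, abs_mul]
    exact mul_le_mul (hM x) (hN x) (abs_nonneg _) ((abs_nonneg _).trans (hM x))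

/-- The surviving factor `h` makes every derivative integrable, since the cofactor is bounded. -/
lemma iteratedDeriv_h (n : ℕ) : ∃ a ∈ diffAlgebra, iteratedDeriv n h = h * a := by
  induction n with
  | zero => exact ⟨1, one_mem _, by simp⟩
  | succ n ih =>
    obtain ⟨a, ha, he⟩ := ih
    obtain ⟨-, a', ha', hd⟩ := diffAlgebra_spec ha
    refine ⟨_, add_mem (mul_mem (mul_mem (mul_mem (const_mem (-2)) deriv_g_mem) gh_mem) ha) ha', ?_⟩
    rw [iteratedDeriv_succ, he]
    funext x
    rw [((hasDerivAt_h x).mul (hd x)).deriv]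
    simp
    ring

lemma differentiable_iteratedDeriv_h (n : ℕ) : Differentiable ℝ (iteratedDeriv n h) := by
  obtain ⟨a, ha, he⟩ := iteratedDeriv_h n
  obtain ⟨-, a', ha', hd⟩ := diffAlgebra_spec ha
  rw [he]
  exact fun x => ((hasDerivAt_h x).mul (hd x)).differentiableAt

lemma integrable_iteratedDeriv_h (n : ℕ) : MeasureTheory.Integrable (iteratedDeriv n h) := by
  obtain ⟨a, ha, he⟩ := iteratedDeriv_h n
  obtain ⟨⟨M, hM⟩, -⟩ := diffAlgebra_spec ha
  refine (integrable_h.mul_const M).mono'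
    (differentiable_iteratedDeriv_h n).continuous.aestronglyMeasurable
    (MeasureTheory.ae_of_all _ fun x => ?_)
  rw [he, Pi.mul_apply, norm_mul, Real.norm_of_nonneg (h_pos x).le]
  exact mul_le_mul_of_nonneg_left (hM x) (h_pos x).le

/-- The function `h`, with complex values. -/
def hC (x : ℝ) : ℂ := h x

lemma iteratedDeriv_hC (n : ℕ) : iteratedDeriv n hC = fun x => ((iteratedDeriv n h x : ℝ) : ℂ) := by
  induction n with
  | zero => funext x; simp [hC]
  | succ n ih =>
    rw [iteratedDeriv_succ, iteratedDeriv_succ, ih]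
    funext x
    exact (differentiable_iteratedDeriv_h n x).hasDerivAt.ofReal_comp.deriv

lemma contDiff_hC : ContDiff ℝ (⊤ : ℕ∞) hC := by
  refine contDiff_of_differentiable_iteratedDeriv fun n _ => ?_
  rw [iteratedDeriv_hC]
  exact fun x => (differentiable_iteratedDeriv_h n x).hasDerivAt.ofReal_comp.differentiableAt

lemma integrable_iteratedDeriv_hC (n : ℕ) : MeasureTheory.Integrable (iteratedDeriv n hC) := by
  rw [iteratedDeriv_hC]
  exact (integrable_iteratedDeriv_h n).ofReal

/-! ### Polynomially bounded symbols and decay of the Fourier transform of `h`. -/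

/-- Continuous symbols of at most polynomial growth. -/
def PolyBounded (P : ℝ → ℝ) : Prop :=
  Continuous P ∧ ∃ (C : ℝ) (N : ℕ), ∀ k, |P k| ≤ C * (1 + |k|) ^ N

lemma PolyBounded.continuous {P : ℝ → ℝ} (hP : PolyBounded P) : Continuous P := hP.1

lemma polyBounded_const (r : ℝ) : PolyBounded (fun _ => r) :=
  ⟨continuous_const, |r|, 0, fun k => by simp⟩

lemma polyBounded_id : PolyBounded (fun k => k) :=
  ⟨continuous_id, 1, 1, fun k => by simp⟩

lemma PolyBounded.mul {P Q : ℝ → ℝ} (hP : PolyBounded P) (hQ : PolyBounded Q) :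
    PolyBounded (fun k => P k * Q k) := by
  obtain ⟨hPc, C, N, hC⟩ := hP
  obtain ⟨hQc, D, M, hD⟩ := hQ
  refine ⟨hPc.mul hQc, C * D, N + M, fun k => ?_⟩
  rw [abs_mul, pow_add, mul_mul_mul_comm]
  exact mul_le_mul (hC k) (hD k) (abs_nonneg _) ((abs_nonneg _).trans (hC k))

lemma PolyBounded.add {P Q : ℝ → ℝ} (hP : PolyBounded P) (hQ : PolyBounded Q) :
    PolyBounded (fun k => P k + Q k) := by
  obtain ⟨hPc, C, N, hC⟩ := hP
  obtain ⟨hQc, D, M, hD⟩ := hQ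
  refine ⟨hPc.add hQc, |C| + |D|, N + M, fun k => (abs_add_le _ _).trans ?_⟩
  have h1 : (1 : ℝ) ≤ 1 + |k| := by linarith [abs_nonneg k]
  rw [add_mul]
  refine add_le_add ((hC k).trans ?_) ((hD k).trans ?_)
  · exact mul_le_mul (le_abs_self _) (pow_le_pow_right₀ h1 (by omega)) (by positivity)
      (by positivity)
  · exact mul_le_mul (le_abs_self _) (pow_le_pow_right₀ h1 (by omega)) (by positivity)
      (by positivity)

lemma PolyBounded.sub {P Q : ℝ → ℝ} (hP : PolyBounded P) (hQ : PolyBounded Q) :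
    PolyBounded (fun k => P k - Q k) := by
  simpa [sub_eq_add_neg] using hP.add ((polyBounded_const (-1)).mul hQ)

lemma PolyBounded.pow {P : ℝ → ℝ} (hP : PolyBounded P) (n : ℕ) :
    PolyBounded (fun k => P k ^ n) := by
  induction n with
  | zero => simpa using polyBounded_const 1
  | succ n ih => simpa [pow_succ] using ih.mul hP

lemma continuous_fourier_hC : Continuous (𝓕 hC) := by
  have h1 : Integrable hC := by simpa using integrable_iteratedDeriv_hC 0
  exact VectorFourier.fourierIntegral_continuous Real.continuous_fourierChar
    (by simp only [innerₗ_apply_apply]; fun_prop) h1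

lemma norm_fourier_le (a : ℝ → ℂ) (ξ : ℝ) : ‖𝓕 a ξ‖ ≤ ∫ x, ‖a x‖ :=
  VectorFourier.norm_fourierIntegral_le_integral_norm _ _ _ _ _

lemma norm_fourierInv_le (a : ℝ → ℂ) (x : ℝ) : ‖𝓕⁻ a x‖ ≤ ∫ ξ, ‖a ξ‖ := by
  rw [Real.fourierInv_eq_fourier_neg]
  exact norm_fourier_le a _

lemma fourier_iteratedDeriv_hC (n : ℕ) (ξ : ℝ) :
    𝓕 (iteratedDeriv n hC) ξ = (2 * Real.pi * Complex.I * ξ) ^ n * 𝓕 hC ξ := by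
  have := Real.fourier_iteratedDeriv (N := ⊤) (n := n) contDiff_hC
    (fun n _ => integrable_iteratedDeriv_hC n) (by simp)
  rw [this]
  rfl

lemma exists_fourier_hC_bound (n : ℕ) : ∃ C, ∀ ξ, |2 * Real.pi * ξ| ^ n * ‖𝓕 hC ξ‖ ≤ C := by
  refine ⟨∫ x, ‖iteratedDeriv n hC x‖, fun ξ => ?_⟩
  refine le_trans (le_of_eq ?_) (norm_fourier_le (iteratedDeriv n hC) ξ)
  rw [fourier_iteratedDeriv_hC, norm_mul, norm_pow]
  simp [abs_mul]

lemma exists_weighted_fourier_hC_bound (N : ℕ) :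
    ∃ C, ∀ ξ, (1 + |2 * Real.pi * ξ|) ^ N * ‖𝓕 hC ξ‖ ≤ C * (1 + ξ ^ 2)⁻¹ := by
  -- The two extra powers pay for the integrable factor `(1 + ξ²)⁻¹`.
  obtain ⟨C, hb⟩ := exists_fourier_hC_bound (N + 2)
  obtain ⟨D, hD⟩ := exists_fourier_hC_bound 0
  refine ⟨2 ^ (N + 2) * (D + C), fun ξ => ?_⟩
  set k := |2 * Real.pi * ξ| with hk
  have hk0 : 0 ≤ k := abs_nonneg _
  have h1 : 1 + ξ ^ 2 ≤ (1 + k) ^ 2 := by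
    have h2 : |ξ| ≤ k := by
      rw [hk, abs_mul, abs_of_pos Real.two_pi_pos]
      nlinarith [abs_nonneg ξ, Real.pi_gt_three]
    have h3 : ξ ^ 2 = |ξ| ^ 2 := (sq_abs ξ).symm
    nlinarith [abs_nonneg ξ]
  have h4 : (1 + k) ^ (N + 2) ≤ 2 ^ (N + 2) * (1 + k ^ (N + 2)) := by
    have h5 := add_pow_le (zero_le_one' ℝ) hk0 (N + 2)
    rw [one_pow] at h5
    refine h5.trans ?_
    gcongr
    · norm_num
    · omega
  have h6 := hb ξ
  have h7 := hD ξ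
  rw [pow_zero, one_mul] at h7
  rw [← div_eq_mul_inv, le_div_iff₀ (by positivity)]
  calc (1 + k) ^ N * ‖𝓕 hC ξ‖ * (1 + ξ ^ 2) ≤ (1 + k) ^ N * ‖𝓕 hC ξ‖ * (1 + k) ^ 2 := by gcongr
    _ = (1 + k) ^ (N + 2) * ‖𝓕 hC ξ‖ := by ring
    _ ≤ 2 ^ (N + 2) * (1 + k ^ (N + 2)) * ‖𝓕 hC ξ‖ := by gcongr
    _ = 2 ^ (N + 2) * (‖𝓕 hC ξ‖ + k ^ (N + 2) * ‖𝓕 hC ξ‖) := by ring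
    _ ≤ 2 ^ (N + 2) * (D + C) := by gcongr

lemma integrable_weighted_fourier_hC (N : ℕ) :
    Integrable fun ξ : ℝ => (1 + |2 * Real.pi * ξ|) ^ N * ‖𝓕 hC ξ‖ := by
  obtain ⟨C, hb⟩ := exists_weighted_fourier_hC_bound N
  have := continuous_fourier_hC
  refine (integrable_inv_one_add_sq.const_mul C).mono'
    (by fun_prop : Continuous _).aestronglyMeasurable (ae_of_all _ fun ξ => ?_)
  rw [Real.norm_of_nonneg (by positivity)]
  exact hb ξ

lemma PolyBounded.integrable {P : ℝ → ℝ} (hP : PolyBounded P) :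
    Integrable fun ξ : ℝ => (P (2 * Real.pi * ξ) : ℂ) * 𝓕 hC ξ := by
  obtain ⟨hPc, C, N, hb⟩ := hP
  have := continuous_fourier_hC
  refine ((integrable_weighted_fourier_hC N).const_mul C).mono'
    (by fun_prop : Continuous _).aestronglyMeasurable (ae_of_all _ fun ξ => ?_)
  rw [norm_mul, Complex.norm_real, Real.norm_eq_abs, ← mul_assoc]
  exact mul_le_mul_of_nonneg_right (hb _) (norm_nonneg _)

/-! ### Calculus of multipliers applied to `h`. -/

/-- The constant is a weighted `L¹` norm of the Fourier transform of `h`; it depends on neither the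
symbol nor `x`. Limits `c → ∞` of multipliers thus reduce to pointwise bounds on symbols. -/
lemma exists_multiplier_bound (N : ℕ) : ∃ K, 0 ≤ K ∧ ∀ (P : ℝ → ℝ) (δ : ℝ),
    (∀ k, |P k| ≤ δ * (1 + |k|) ^ N) → ∀ x, ‖multiplier P hC x‖ ≤ K * δ := by
  refine ⟨∫ ξ : ℝ, (1 + |2 * Real.pi * ξ|) ^ N * ‖𝓕 hC ξ‖,
    integral_nonneg fun ξ => by positivity, fun P δ hδ x => ?_⟩
  refine (norm_fourierInv_le _ x).trans ?_
  rw [mul_comm _ δ, ← integral_const_mul]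
  refine integral_mono_of_nonneg (ae_of_all _ fun ξ => norm_nonneg _)
    ((integrable_weighted_fourier_hC N).const_mul δ) (ae_of_all _ fun ξ => ?_)
  simp only [norm_mul, Complex.norm_real, Real.norm_eq_abs, ← mul_assoc]
  exact mul_le_mul_of_nonneg_right (hδ _) (norm_nonneg _)

lemma fourierInv_add {a b : ℝ → ℂ} (ha : Integrable a) (hb : Integrable b) (x : ℝ) :
    𝓕⁻ (fun ξ => a ξ + b ξ) x = 𝓕⁻ a x + 𝓕⁻ b x := by
  simp only [Real.fourierInv_eq, smul_add]
  have h (a : ℝ → ℂ) (ha : Integrable a) :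
      Integrable fun v => Real.fourierChar (inner ℝ v x) • a v := by
    have := (Real.fourierIntegral_convergent_iff (-x)).2 ha
    simpa using this
  exact integral_add (h a ha) (h b hb)

lemma fourierInv_const_mul (r : ℂ) (a : ℝ → ℂ) (x : ℝ) :
    𝓕⁻ (fun ξ => r * a ξ) x = r * 𝓕⁻ a x := by
  simp only [Real.fourierInv_eq, ← integral_const_mul, mul_smul_comm]

lemma multiplier_add {P Q : ℝ → ℝ} (hP : PolyBounded P) (hQ : PolyBounded Q) (x : ℝ) :
    multiplier (fun k => P k + Q k) hC x = multiplier P hC x + multiplier Q hC x := by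
  unfold multiplier
  rw [← fourierInv_add hP.integrable hQ.integrable]
  simp only [Complex.ofReal_add, add_mul]

lemma multiplier_const_mul (r : ℝ) (P : ℝ → ℝ) (x : ℝ) :
    multiplier (fun k => r * P k) hC x = r * multiplier P hC x := by
  unfold multiplier
  rw [← fourierInv_const_mul]
  simp only [Complex.ofReal_mul, mul_assoc]

lemma multiplier_sub {P Q : ℝ → ℝ} (hP : PolyBounded P) (hQ : PolyBounded Q) (x : ℝ) :
    multiplier (fun k => P k - Q k) hC x = multiplier P hC x - multiplier Q hC x := by
  have := multiplier_add hP ((polyBounded_const (-1)).mul hQ) x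
  rw [multiplier_const_mul] at this
  simpa [sub_eq_add_neg] using this

lemma contDiff_multiplier {P : ℝ → ℝ} (hP : PolyBounded P) :
    ContDiff ℝ (⊤ : ℕ∞) (multiplier P hC) := by
  have h1 : multiplier P hC =
      fun x => 𝓕 (fun ξ : ℝ => (P (2 * Real.pi * ξ) : ℂ) * 𝓕 hC ξ) (-x) := by
    funext x
    exact Real.fourierInv_eq_fourier_neg _ x
  rw [h1]
  refine ContDiff.comp (Real.contDiff_fourier fun n _ => ?_) contDiff_neg
  -- At `k = 2πξ` the symbol `(k / 2π)ⁿ` is the moment weight `ξⁿ`.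
  have := (((polyBounded_const (2 * Real.pi)⁻¹).mul polyBounded_id).pow n |>.mul hP).integrable.norm
  refine this.congr (ae_of_all _ fun ξ => ?_)
  simp only
  rw [inv_mul_cancel_left₀ (by positivity), Complex.ofReal_mul, mul_assoc, norm_mul,
    Complex.norm_real, norm_pow]

lemma iteratedDeriv_multiplier {P : ℝ → ℝ} (hP : PolyBounded P) (n : ℕ) (x : ℝ) :
    iteratedDeriv n (multiplier P hC) x =
      Complex.I ^ n * multiplier (fun k => k ^ n * P k) hC x := by
  have h1 : multiplier P hC =
      fun x => 𝓕 (fun ξ : ℝ => (P (2 * Real.pi * ξ) : ℂ) * 𝓕 hC ξ) (-x) := by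
    funext x
    exact Real.fourierInv_eq_fourier_neg _ x
  rw [h1, iteratedDeriv_comp_neg, Real.iteratedDeriv_fourier (N := ⊤) _ (by simp)]
  · rw [← Real.fourierInv_eq_fourier_neg, multiplier, ← fourierInv_const_mul, Complex.real_smul,
      ← fourierInv_const_mul]
    refine congrFun (congrArg (fun a : ℝ → ℂ => 𝓕⁻ a) (funext fun ξ => ?_)) x
    push_cast
    have e : (-1 : ℂ) ^ n * (-2 * Real.pi * Complex.I * ξ) ^ n =
        Complex.I ^ n * (2 * Real.pi * ξ) ^ n := by
      rw [← mul_pow, ← mul_pow]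
      ring
    rw [smul_eq_mul]
    linear_combination ((P (2 * Real.pi * ξ) : ℂ) * 𝓕 hC ξ) * e
  · intro n _
    have := (((polyBounded_const (2 * Real.pi)⁻¹).mul polyBounded_id).pow n |>.mul hP).integrable
    refine this.congr (ae_of_all _ fun ξ => ?_)
    simp only
    rw [inv_mul_cancel_left₀ (by positivity), Complex.real_smul]
    push_cast
    ring

lemma multiplier_one (x : ℝ) : multiplier (fun _ => 1) hC x = hC x := by
  have h1 : Integrable hC := by simpa using integrable_iteratedDeriv_hC 0
  have h2 : Integrable (𝓕 hC) := by simpa using (polyBounded_const 1).integrable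
  have := contDiff_hC.continuous.fourierInv_fourier_eq h1 h2
  simpa [multiplier] using congrFun this x

lemma multiplier_pow (n : ℕ) (x : ℝ) :
    Complex.I ^ n * multiplier (fun k => k ^ n) hC x = iteratedDeriv n hC x := by
  have := iteratedDeriv_multiplier (polyBounded_const 1) n x
  simp only [mul_one, funext multiplier_one] at this
  exact this.symm

lemma multiplier_id (x : ℝ) : multiplier (fun k => k) hC x = -Complex.I * deriv hC x := by
  have := multiplier_pow 1 x
  simp only [pow_one, iteratedDeriv_one] at this
  rw [← this, ← mul_assoc]
  simp

lemma multiplier_sq (x : ℝ) : multiplier (fun k => k ^ 2) hC x = -iteratedDeriv 2 hC x := by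
  rw [← multiplier_pow 2 x]
  simp

lemma fourier_hC_neg (ξ : ℝ) : 𝓕 hC (-ξ) = 𝓕 hC ξ := by
  rw [← Real.fourierInv_eq_fourier_neg, Real.fourierInv_eq_fourier_comp_neg]
  refine congrFun (congrArg (fun a : ℝ → ℂ => 𝓕 a) (funext fun x => ?_)) ξ
  simp [hC, h_neg]

lemma multiplier_neg {P : ℝ → ℝ} (hP : ∀ k, P (-k) = P k) (x : ℝ) :
    multiplier P hC (-x) = multiplier P hC x := by
  unfold multiplier
  rw [Real.fourierInv_eq_fourier_neg, neg_neg, Real.fourierInv_eq_fourier_comp_neg]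
  refine congrFun (congrArg (fun a : ℝ → ℂ => 𝓕 a) (funext fun ξ => ?_)) x
  rw [fourier_hC_neg, mul_neg, hP]

/-! ### Integrability of multipliers. -/

/-- Two integrations by parts bound `(1 + 4π²ξ²) |𝓕 κ|` by `‖κ‖₁ + ‖κ''‖₁`. -/
lemma integrable_fourier_of_deriv {κ κ' κ'' : ℝ → ℂ} (h1 : ∀ x, HasDerivAt κ (κ' x) x)
    (h2 : ∀ x, HasDerivAt κ' (κ'' x) x) (i0 : Integrable κ) (i1 : Integrable κ')
    (i2 : Integrable κ'') : Integrable (𝓕 κ) := by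
  have e1 : deriv κ = κ' := funext fun x => (h1 x).deriv
  have e2 : deriv κ' = κ'' := funext fun x => (h2 x).deriv
  have f1 := Real.fourier_deriv i0 (fun x => (h1 x).differentiableAt) (by rwa [e1])
  have f2 := Real.fourier_deriv i1 (fun x => (h2 x).differentiableAt) (by rwa [e2])
  rw [e1] at f1
  rw [e2, f1] at f2
  have hc : Continuous (𝓕 κ) :=
    VectorFourier.fourierIntegral_continuous Real.continuous_fourierChar
      (by simp only [innerₗ_apply_apply]; fun_prop) i0
  refine (integrable_inv_one_add_sq.const_mul ((∫ x, ‖κ x‖) + ∫ x, ‖κ'' x‖)).mono'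
    hc.aestronglyMeasurable (ae_of_all _ fun x => ?_)
  have b0 := norm_fourier_le κ x
  have b2 := norm_fourier_le κ'' x
  rw [f2] at b2
  simp only [norm_smul, norm_mul, Complex.norm_real, Complex.norm_I, Complex.norm_ofNat,
    Real.norm_eq_abs, abs_of_pos Real.pi_pos] at b2
  rw [← div_eq_mul_inv, le_div_iff₀ (by positivity)]
  have h3 : x ^ 2 ≤ (2 * Real.pi * 1 * |x|) * (2 * Real.pi * 1 * |x|) := by
    rw [← sq_abs, sq]
    have : |x| ≤ 2 * Real.pi * 1 * |x| := by
      nlinarith [abs_nonneg x, Real.pi_gt_three]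
    gcongr
  calc ‖𝓕 κ x‖ * (1 + x ^ 2)
      ≤ ‖𝓕 κ x‖ * (1 + (2 * Real.pi * 1 * |x|) * (2 * Real.pi * 1 * |x|)) := by gcongr
    _ = ‖𝓕 κ x‖ + 2 * Real.pi * 1 * |x| * (2 * Real.pi * 1 * |x| * ‖𝓕 κ x‖) := by ring
    _ ≤ _ := add_le_add b0 b2

lemma integrable_of_abs_le {κ : ℝ → ℝ} (hκ : Continuous κ) {C : ℝ}
    (hC : ∀ k, |κ k| ≤ C * (1 + k ^ 2)⁻¹) : Integrable fun ξ : ℝ => (κ (2 * Real.pi * ξ) : ℂ) := by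
  have h1 : Integrable κ := (integrable_inv_one_add_sq.const_mul C).mono'
    hκ.aestronglyMeasurable (ae_of_all _ hC)
  exact (h1.comp_mul_left' (by positivity : 2 * Real.pi ≠ 0)).ofReal

lemma integrable_fourier_of_abs_le {κ κ' κ'' : ℝ → ℝ} (h1 : ∀ x, HasDerivAt κ (κ' x) x)
    (h2 : ∀ x, HasDerivAt κ' (κ'' x) x) (hκ : Continuous κ'') {C : ℝ}
    (c0 : ∀ k, |κ k| ≤ C * (1 + k ^ 2)⁻¹) (c1 : ∀ k, |κ' k| ≤ C * (1 + k ^ 2)⁻¹)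
    (c2 : ∀ k, |κ'' k| ≤ C * (1 + k ^ 2)⁻¹) :
    Integrable (𝓕 fun ξ : ℝ => (κ (2 * Real.pi * ξ) : ℂ)) := by
  have k1 : Continuous κ := continuous_iff_continuousAt.2 fun y => (h1 y).continuousAt
  have k2 : Continuous κ' := continuous_iff_continuousAt.2 fun y => (h2 y).continuousAt
  have hs : ∀ {ψ ψ' : ℝ → ℝ}, (∀ x, HasDerivAt ψ (ψ' x) x) → ∀ x : ℝ,
      HasDerivAt (fun ξ : ℝ => (ψ (2 * Real.pi * ξ) : ℂ))
        ((2 * Real.pi : ℝ) * (ψ' (2 * Real.pi * x) : ℂ)) x := by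
    intro ψ ψ' hψ x
    have h3 : HasDerivAt (fun ξ : ℝ => 2 * Real.pi * ξ) (2 * Real.pi) x := by
      simpa using (hasDerivAt_id x).const_mul (2 * Real.pi)
    have h4 : HasDerivAt (fun ξ : ℝ => ψ (2 * Real.pi * ξ))
        (ψ' (2 * Real.pi * x) * (2 * Real.pi)) x := (hψ _).comp x h3
    exact h4.ofReal_comp.congr_deriv (by push_cast; ring)
  exact integrable_fourier_of_deriv (hs h1) (fun x => (hs h2 x).const_mul _)
    (integrable_of_abs_le k1 c0) ((integrable_of_abs_le k2 c1).const_mul _)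
    (((integrable_of_abs_le hκ c2).const_mul _).const_mul _)

lemma hasDerivAt_weight (k : ℝ) :
    HasDerivAt (fun k : ℝ => ((1 + k ^ 2) ^ 2)⁻¹) (-4 * k / (1 + k ^ 2) ^ 3) k := by
  have h1 := (((hasDerivAt_id k).pow 2).const_add 1).pow 2
  have h2 := h1.inv (by simp; positivity)
  refine h2.congr_deriv ?_
  simp
  field_simp
  ring

lemma hasDerivAt_weight_deriv (k : ℝ) :
    HasDerivAt (fun k : ℝ => -4 * k / (1 + k ^ 2) ^ 3)
      ((20 * k ^ 2 - 4) / (1 + k ^ 2) ^ 4) k := by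
  have h1 := (((hasDerivAt_id k).pow 2).const_add 1).pow 3
  have h2 := ((hasDerivAt_id k).const_mul (-4)).div h1 (by simp; positivity)
  refine h2.congr_deriv ?_
  simp
  field_simp
  ring

/-- Symbols with two derivatives of quadratic growth give integrable functions. -/
lemma fourier_multiplier {K K' K'' : ℝ → ℝ} (h1 : ∀ x, HasDerivAt K (K' x) x)
    (h2 : ∀ x, HasDerivAt K' (K'' x) x) (hK : Continuous K'') {C : ℝ}
    (c0 : ∀ k, |K k| ≤ C * (1 + k ^ 2)) (c1 : ∀ k, |K' k| ≤ C * (1 + k ^ 2))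
    (c2 : ∀ k, |K'' k| ≤ C * (1 + k ^ 2)) :
    Integrable (multiplier K hC) ∧
      𝓕 (multiplier K hC) = fun ξ : ℝ => (K (2 * Real.pi * ξ) : ℂ) * 𝓕 hC ξ := by
  have k1 : Continuous K := continuous_iff_continuousAt.2 fun y => (h1 y).continuousAt
  have hCpos : 0 ≤ C := by simpa using (abs_nonneg _).trans (c0 0)
  -- The product `K w` and its first two derivatives are `O((1 + k²)⁻¹)`, so it is the Fourier
  -- transform of an integrable function. The compensating factor `(1 + k²)²` is moved onto `h`.
  set w : ℝ → ℝ := fun k => ((1 + k ^ 2) ^ 2)⁻¹ with hw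
  set w' : ℝ → ℝ := fun k => -4 * k / (1 + k ^ 2) ^ 3 with hw'
  set w'' : ℝ → ℝ := fun k => (20 * k ^ 2 - 4) / (1 + k ^ 2) ^ 4 with hw''
  have bw : ∀ k, |w k| ≤ ((1 + k ^ 2) ^ 2)⁻¹ := fun k => by
    rw [abs_of_nonneg (by positivity)]
  have bw' : ∀ k, |w' k| ≤ 2 * ((1 + k ^ 2) ^ 2)⁻¹ := fun k => by
    rw [hw', abs_div, abs_of_nonneg (by positivity : 0 ≤ (1 + k ^ 2) ^ 3), div_le_iff₀
      (by positivity)]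
    have : 2 * ((1 + k ^ 2) ^ 2)⁻¹ * (1 + k ^ 2) ^ 3 = 2 * (1 + k ^ 2) := by field_simp
    rw [this, abs_le]
    constructor <;> nlinarith [sq_nonneg (k - 1), sq_nonneg (k + 1)]
  have bw'' : ∀ k, |w'' k| ≤ 20 * ((1 + k ^ 2) ^ 2)⁻¹ := fun k => by
    rw [hw'', abs_div, abs_of_nonneg (by positivity : 0 ≤ (1 + k ^ 2) ^ 4), div_le_iff₀
      (by positivity)]
    have : 20 * ((1 + k ^ 2) ^ 2)⁻¹ * (1 + k ^ 2) ^ 4 = 20 * (1 + k ^ 2) ^ 2 := by field_simp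
    rw [this, abs_le]
    constructor <;> nlinarith [sq_nonneg (k ^ 2), sq_nonneg k]
  have hprod : ∀ {p q b d k : ℝ}, |p| ≤ C * (1 + k ^ 2) → |q| ≤ d * ((1 + k ^ 2) ^ 2)⁻¹ → d ≤ b →
      |p * q| ≤ C * b * (1 + k ^ 2)⁻¹ := by
    intro p q b d k hp hq hd
    rw [abs_mul]
    calc |p| * |q| ≤ (C * (1 + k ^ 2)) * (b * ((1 + k ^ 2) ^ 2)⁻¹) :=
          mul_le_mul hp (hq.trans (by gcongr)) (abs_nonneg _) (by positivity)
      _ = C * b * (1 + k ^ 2)⁻¹ := by field_simp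
  have hone : ∀ k, |w k| ≤ 1 * ((1 + k ^ 2) ^ 2)⁻¹ := fun k => by simpa using bw k
  have hκint : Integrable
      (𝓕 fun ξ : ℝ => ((K (2 * Real.pi * ξ) * w (2 * Real.pi * ξ) : ℝ) : ℂ)) := by
    refine integrable_fourier_of_abs_le (κ := fun k => K k * w k)
      (κ' := fun k => K' k * w k + K k * w' k)
      -- Four terms, each with weight constant at most 20, give 80.
      (κ'' := fun k => (K'' k * w k + K' k * w' k) + (K' k * w' k + K k * w'' k)) (C := C * 80)
      (fun x => (h1 x).mul (hasDerivAt_weight x))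
      (fun x => ((h2 x).mul (hasDerivAt_weight x)).add ((h1 x).mul (hasDerivAt_weight_deriv x)))
      ?_ ?_ ?_ ?_
    · have k2 : Continuous K' := continuous_iff_continuousAt.2 fun y => (h2 y).continuousAt
      have l0 : Continuous w :=
        continuous_iff_continuousAt.2 fun y => (hasDerivAt_weight y).continuousAt
      have l1 : Continuous w' :=
        continuous_iff_continuousAt.2 fun y => (hasDerivAt_weight_deriv y).continuousAt
      have l2 : Continuous w'' := by
        refine Continuous.div (by fun_prop) (by fun_prop) fun k => by positivity
      fun_prop
    · exact fun k => hprod (c0 k) (hone k) (by norm_num)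
    · intro k
      have a1 := hprod (b := 20) (c1 k) (hone k) (by norm_num)
      have a2 := hprod (b := 20) (c0 k) (bw' k) (by norm_num)
      have := abs_add_le (K' k * w k) (K k * w' k)
      have : 0 ≤ C * (1 + k ^ 2)⁻¹ := by positivity
      nlinarith
    · intro k
      have a1 := hprod (b := 20) (c2 k) (hone k) (by norm_num)
      have a2 := hprod (b := 20) (c1 k) (bw' k) (by norm_num)
      have a3 := hprod (b := 20) (c0 k) (bw'' k) (by norm_num)
      have := abs_add_le (K'' k * w k + K' k * w' k) (K' k * w' k + K k * w'' k)
      have := abs_add_le (K'' k * w k) (K' k * w' k)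
      have := abs_add_le (K' k * w' k) (K k * w'' k)
      nlinarith
  set κ : ℝ → ℂ := fun ξ => ((K (2 * Real.pi * ξ) * w (2 * Real.pi * ξ) : ℝ) : ℂ) with hκ
  have hwc : Continuous w :=
    continuous_iff_continuousAt.2 fun y => (hasDerivAt_weight y).continuousAt
  have hκc : Continuous κ := by fun_prop
  have hκi : Integrable κ := integrable_of_abs_le (κ := fun k => K k * w k) (by fun_prop)
    (fun k => hprod (c0 k) (hone k) le_rfl)
  have hinv : Integrable (𝓕⁻ κ) := by
    have : 𝓕⁻ κ = fun x => 𝓕 κ (-x) := funext fun x => Real.fourierInv_eq_fourier_neg _ x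
    rw [this]
    exact hκint.comp_neg
  have hinvc : Continuous (𝓕⁻ κ) := by
    have : 𝓕⁻ κ = fun x => 𝓕 κ (-x) := funext fun x => Real.fourierInv_eq_fourier_neg _ x
    rw [this]
    exact (VectorFourier.fourierIntegral_continuous Real.continuous_fourierChar
      (by simp only [innerₗ_apply_apply]; fun_prop) hκi).comp continuous_neg
  have hFκ : 𝓕 (𝓕⁻ κ) = κ := hκc.fourier_fourierInv_eq hκi hκint
  -- This is `(1 - d²/dx²)² h`, with Fourier transform `(1 + k²)² 𝓕 h`. The multiplier is then the
  -- convolution of two integrable functions.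
  set φ : ℝ → ℂ := (hC + (-2 : ℂ) • iteratedDeriv 2 hC) + iteratedDeriv 4 hC with hφ
  have i0 : Integrable hC := by simpa using integrable_iteratedDeriv_hC 0
  have i2 := (integrable_iteratedDeriv_hC 2).smul (-2 : ℂ)
  have i4 := integrable_iteratedDeriv_hC 4
  have hφi : Integrable φ := (i0.add i2).add i4
  have hFφ : ∀ ξ, 𝓕 φ ξ = (1 + (2 * Real.pi * ξ) ^ 2) ^ 2 * 𝓕 hC ξ := by
    intro ξ
    have hadd : ∀ {a b : ℝ → ℂ}, Integrable a → Integrable b →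
        𝓕 (a + b) ξ = 𝓕 a ξ + 𝓕 b ξ := fun {a b} ha hb => by
      have := fourierInv_add ha hb (-ξ)
      simp only [Real.fourierInv_eq_fourier_neg, neg_neg] at this
      exact this
    have hsm : ∀ a : ℝ → ℂ, 𝓕 ((-2 : ℂ) • a) ξ = -2 * 𝓕 a ξ := fun a => by
      have := fourierInv_const_mul (-2) a (-ξ)
      simp only [Real.fourierInv_eq_fourier_neg, neg_neg] at this
      exact this
    rw [hφ, hadd (i0.add i2) i4, hadd i0 i2, hsm, fourier_iteratedDeriv_hC,
      fourier_iteratedDeriv_hC]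
    linear_combination (-2 * (2 * Real.pi * ξ : ℂ) ^ 2 * 𝓕 hC ξ +
      (2 * Real.pi * ξ : ℂ) ^ 4 * 𝓕 hC ξ * (Complex.I ^ 2 - 1)) * Complex.I_sq
  set conv : ℝ → ℂ := MeasureTheory.convolution (𝓕⁻ κ) φ (ContinuousLinearMap.mul ℂ ℂ) volume
    with hconv
  have hci : Integrable conv := hinv.integrable_convolution _ hφi
  have hcc : Continuous conv := by
    refine BddAbove.continuous_convolution_left_of_integrable _ ?_ hinvc hφi
    refine ⟨∫ ξ, ‖κ ξ‖, ?_⟩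
    rintro _ ⟨x, rfl⟩
    exact norm_fourierInv_le κ x
  have hFc : 𝓕 conv = fun ξ : ℝ => (K (2 * Real.pi * ξ) : ℂ) * 𝓕 hC ξ := by
    funext ξ
    rw [hconv, Real.fourier_mul_convolution_eq hinv hφi, hFκ, hFφ, hκ]
    have : ((1 : ℂ) + (2 * Real.pi * ξ) ^ 2) ≠ 0 := by
      have : (0 : ℝ) < 1 + (2 * Real.pi * ξ) ^ 2 := by positivity
      exact_mod_cast this.ne'
    simp only [hw]
    push_cast
    rw [mul_assoc, inv_mul_cancel_left₀ (pow_ne_zero 2 this)]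
  have hPB : PolyBounded K := ⟨k1, C, 2, fun k => (c0 k).trans (by
    gcongr
    have := sq_abs k
    nlinarith [abs_nonneg k])⟩
  have hmul : multiplier K hC = conv := by
    unfold multiplier
    rw [← hFc]
    exact hcc.fourierInv_fourier_eq hci (by rw [hFc]; exact hPB.integrable)
  rw [hmul]
  exact ⟨hci, hFc⟩

/-! ### Multipliers and modulation by `e^{isx}`. -/

lemma integrable_fourierChar_smul {a : ℝ → ℂ} (ha : Integrable a) (ξ : ℝ) :
    Integrable fun v : ℝ => Real.fourierChar (-(inner ℝ v ξ)) • a v :=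
  (Real.fourierIntegral_convergent_iff ξ).2 ha

lemma fourier_const_mul (r : ℂ) (a : ℝ → ℂ) (ξ : ℝ) :
    𝓕 (fun x => r * a x) ξ = r * 𝓕 a ξ := by
  have := fourierInv_const_mul r a (-ξ)
  simpa only [Real.fourierInv_eq_fourier_neg, neg_neg] using this

lemma fourier_sub {a b : ℝ → ℂ} (ha : Integrable a) (hb : Integrable b) (ξ : ℝ) :
    𝓕 (fun x => a x - b x) ξ = 𝓕 a ξ - 𝓕 b ξ := by
  simp only [Real.fourier_eq, smul_sub]
  exact integral_sub (integrable_fourierChar_smul ha ξ) (integrable_fourierChar_smul hb ξ)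

lemma fourierInv_sub {a b : ℝ → ℂ} (ha : Integrable a) (hb : Integrable b) (x : ℝ) :
    𝓕⁻ (fun ξ => a ξ - b ξ) x = 𝓕⁻ a x - 𝓕⁻ b x := by
  simp only [Real.fourierInv_eq_fourier_neg]
  exact fourier_sub ha hb _

lemma fourier_exp_mul (s : ℝ) (a : ℝ → ℂ) (ξ : ℝ) :
    𝓕 (fun x : ℝ => Complex.exp (s * x * Complex.I) * a x) ξ = 𝓕 a (ξ - s / (2 * Real.pi)) := by
  simp only [Real.fourier_eq']
  congr 1
  funext v
  rw [smul_eq_mul, smul_eq_mul, ← mul_assoc, ← Complex.exp_add]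
  congr 2
  simp only [RCLike.inner_apply, conj_trivial]
  push_cast
  field_simp
  ring

lemma fourierInv_shift (s : ℝ) (a : ℝ → ℂ) (x : ℝ) :
    𝓕⁻ (fun ξ : ℝ => a (ξ - s / (2 * Real.pi))) x = Complex.exp (s * x * Complex.I) * 𝓕⁻ a x := by
  simp only [Real.fourierInv_eq']
  rw [← integral_const_mul, ← integral_sub_right_eq_self (fun v : ℝ =>
    Complex.exp (s * x * Complex.I) *
      (Complex.exp ((2 * Real.pi * inner ℝ v x : ℝ) * Complex.I) • a v)) (s / (2 * Real.pi))]
  congr 1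
  funext v
  rw [smul_eq_mul, smul_eq_mul, ← mul_assoc, ← Complex.exp_add]
  congr 2
  simp only [RCLike.inner_apply, conj_trivial]
  push_cast
  field_simp
  ring

lemma multiplier_const_mul_right (Q : ℝ → ℝ) (r : ℂ) (φ : ℝ → ℂ) (x : ℝ) :
    multiplier Q (fun y => r * φ y) x = r * multiplier Q φ x := by
  unfold multiplier
  rw [← fourierInv_const_mul]
  refine congrFun (congrArg (fun a : ℝ → ℂ => 𝓕⁻ a) (funext fun ξ => ?_)) x
  rw [fourier_const_mul]
  ring

lemma PolyBounded.comp_add_const {P : ℝ → ℝ} (hP : PolyBounded P) (s : ℝ) :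
    PolyBounded (fun k => P (k + s)) := by
  obtain ⟨hPc, C, N, hb⟩ := hP
  have hC : 0 ≤ C := by simpa using (abs_nonneg _).trans (hb 0)
  refine ⟨by fun_prop, C * (1 + |s|) ^ N, N, fun k => (hb _).trans ?_⟩
  rw [mul_assoc, ← mul_pow]
  gcongr
  have := abs_add_le k s
  nlinarith [abs_nonneg k, abs_nonneg s, mul_nonneg (abs_nonneg k) (abs_nonneg s)]

lemma sin_eq_exp (x : ℝ) : (Real.sin x : ℂ) = (2 * Complex.I)⁻¹ *
    (Complex.exp ((1 : ℝ) * x * Complex.I) - Complex.exp ((-1 : ℝ) * x * Complex.I)) := by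
  rw [Complex.ofReal_sin, Complex.sin]
  have := Complex.I_ne_zero
  field_simp
  push_cast
  ring_nf
  simp only [Complex.I_sq]
  ring_nf

/-- Multipliers commute with modulations up to a translation of the symbol. -/
lemma multiplier_mul_sin {K Q : ℝ → ℝ} (hK : PolyBounded K) (hQ : PolyBounded Q)
    (hi : Integrable (multiplier K hC))
    (hF : 𝓕 (multiplier K hC) = fun ξ : ℝ => (K (2 * Real.pi * ξ) : ℂ) * 𝓕 hC ξ) (x : ℝ) :
    multiplier Q (fun y => multiplier K hC y * (Real.sin y : ℂ)) x =
      (2 * Complex.I)⁻¹ *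
        (Complex.exp ((1 : ℝ) * x * Complex.I) * multiplier (fun k => Q (k + 1) * K k) hC x -
          Complex.exp ((-1 : ℝ) * x * Complex.I) *
            multiplier (fun k => Q (k + -1) * K k) hC x) := by
  set F := multiplier K hC with hFdef
  have hei : ∀ s : ℝ, Integrable fun x : ℝ => Complex.exp (s * x * Complex.I) * F x := fun s => by
    refine hi.bdd_mul (c := 1) (by fun_prop : Continuous _).aestronglyMeasurable
      (ae_of_all _ fun x => ?_)
    rw [← Complex.ofReal_mul, Complex.norm_exp_ofReal_mul_I]
  have h1 : (fun y => F y * (Real.sin y : ℂ)) = fun y : ℝ => (2 * Complex.I)⁻¹ *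
      (Complex.exp ((1 : ℝ) * y * Complex.I) * F y -
        Complex.exp ((-1 : ℝ) * y * Complex.I) * F y) := by
    funext y
    rw [sin_eq_exp]
    ring
  rw [h1, multiplier_const_mul_right]
  congr 1
  have hs : ∀ s : ℝ, PolyBounded fun k => Q (k + s) * K k := fun s => (hQ.comp_add_const s).mul hK
  have hpi : (2 * Real.pi) ≠ 0 := by positivity
  have hshift : ∀ s ξ : ℝ, (Q (2 * Real.pi * ξ) : ℂ) * 𝓕 F (ξ - s / (2 * Real.pi)) =
      (fun ξ : ℝ => ((Q (2 * Real.pi * ξ + s) * K (2 * Real.pi * ξ) : ℝ) : ℂ) * 𝓕 hC ξ)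
        (ξ - s / (2 * Real.pi)) := by
    intro s ξ
    have : 2 * Real.pi * (ξ - s / (2 * Real.pi)) + s = 2 * Real.pi * ξ := by
      field_simp
      ring
    simp only [hF, this, Complex.ofReal_mul]
    ring
  have hint : ∀ s : ℝ, Integrable fun ξ : ℝ =>
      (Q (2 * Real.pi * ξ) : ℂ) * 𝓕 F (ξ - s / (2 * Real.pi)) := fun s => by
    simp only [hshift]
    exact (hs s).integrable.comp_sub_right _
  have h2 : ∀ s : ℝ, 𝓕⁻ (fun ξ : ℝ => (Q (2 * Real.pi * ξ) : ℂ) * 𝓕 F (ξ - s / (2 * Real.pi))) x =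
      Complex.exp (s * x * Complex.I) * multiplier (fun k => Q (k + s) * K k) hC x := fun s => by
    simp only [hshift s]
    exact fourierInv_shift s
      (fun ξ : ℝ => ((Q (2 * Real.pi * ξ + s) * K (2 * Real.pi * ξ) : ℝ) : ℂ) * 𝓕 hC ξ) x
  rw [← h2, ← h2, ← fourierInv_sub (hint 1) (hint (-1))]
  unfold multiplier
  refine congrFun (congrArg (fun a : ℝ → ℂ => 𝓕⁻ a) (funext fun ξ => ?_)) x
  rw [fourier_sub (hei 1) (hei (-1)), fourier_exp_mul, fourier_exp_mul, mul_sub]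

/-! ### The relativistic symbols. -/

/-- The symbol `√(k² + μ²)`. -/
def S (μ k : ℝ) : ℝ := √(k ^ 2 + μ ^ 2)

lemma S_sq (μ k : ℝ) : S μ k ^ 2 = k ^ 2 + μ ^ 2 := Real.sq_sqrt (by positivity)

lemma le_S {μ : ℝ} (k : ℝ) : μ ≤ S μ k := Real.le_sqrt_of_sq_le (by nlinarith)

lemma S_le {μ : ℝ} (hμ : 0 < μ) (k : ℝ) : S μ k ≤ |k| + μ := by
  refine Real.sqrt_le_iff.2 ⟨by positivity, ?_⟩
  nlinarith [sq_abs k, mul_nonneg (abs_nonneg k) hμ.le]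

lemma S_pos {μ : ℝ} (hμ : 0 < μ) (k : ℝ) : 0 < S μ k := hμ.trans_le (le_S k)

lemma hasDerivAt_S {μ : ℝ} (hμ : 0 < μ) (k : ℝ) : HasDerivAt (S μ) (k / S μ k) k := by
  have h1 := (((hasDerivAt_id k).pow 2).add_const (μ ^ 2)).sqrt (by simp; positivity)
  refine h1.congr_deriv ?_
  simp [S]
  field_simp

lemma hasDerivAt_S_deriv {μ : ℝ} (hμ : 0 < μ) (k : ℝ) :
    HasDerivAt (fun k => k / S μ k) (μ ^ 2 / S μ k ^ 3) k := by
  have h0 := (S_pos hμ k).ne'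
  refine ((hasDerivAt_id k).div (hasDerivAt_S hμ k) h0).congr_deriv ?_
  simp only [id]
  field_simp
  rw [S_sq]
  ring

lemma continuous_S (μ : ℝ) : Continuous (S μ) := by unfold S; fun_prop

lemma polyBounded_S {μ : ℝ} (hμ : 0 < μ) : PolyBounded (S μ) :=
  ⟨continuous_S μ, 1 + μ, 1, fun k => by
    rw [abs_of_pos (S_pos hμ k)]
    nlinarith [S_le hμ k, abs_nonneg k, mul_nonneg (abs_nonneg k) hμ.le]⟩

/-- The symbol `√((k + 1)² + μ²) + √((k - 1)² + μ²)`. -/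
def K (μ k : ℝ) : ℝ := S μ (k + 1) + S μ (k + -1)

lemma polyBounded_K {μ : ℝ} (hμ : 0 < μ) : PolyBounded (K μ) :=
  ((polyBounded_S hμ).comp_add_const 1).add ((polyBounded_S hμ).comp_add_const (-1))

lemma K_neg (μ k : ℝ) : K μ (-k) = K μ k := by
  unfold K S
  rw [add_comm]
  congr 2 <;> ring

/-- A second multiplier acts on `f_c sin`, so the Fourier transform of `K(p) h` must be known as a
genuine integral. The growth conditions hold because `|S'| ≤ 1` and `S'' = μ² / S³ ≤ 1 / μ`. -/
lemma fourier_multiplier_K {μ : ℝ} (hμ : 0 < μ) : Integrable (multiplier (K μ) hC) ∧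
    𝓕 (multiplier (K μ) hC) = fun ξ : ℝ => (K μ (2 * Real.pi * ξ) : ℂ) * 𝓕 hC ξ := by
  have b1 : ∀ k, |k / S μ k| ≤ 1 := fun k => by
    rw [abs_div, abs_of_pos (S_pos hμ k), div_le_one (S_pos hμ k)]
    exact Real.abs_le_sqrt (by nlinarith)
  have b2 : ∀ k, |μ ^ 2 / S μ k ^ 3| ≤ 1 / μ := fun k => by
    have := S_pos hμ k
    rw [abs_of_pos (by positivity), div_le_div_iff₀ (by positivity) hμ, one_mul, ← pow_succ]
    exact pow_le_pow_left₀ hμ.le (le_S k) 3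
  have hsq : ∀ k : ℝ, 1 ≤ 1 + k ^ 2 := fun k => by nlinarith [sq_nonneg k]
  have hμ' : 0 < 1 / μ := by positivity
  refine fourier_multiplier (K := K μ)
    (K' := fun k => (k + 1) / S μ (k + 1) + (k + -1) / S μ (k + -1))
    (K'' := fun k => μ ^ 2 / S μ (k + 1) ^ 3 + μ ^ 2 / S μ (k + -1) ^ 3)
    (C := 2 * (2 + μ) + 2 * (1 / μ)) ?_ ?_ ?_ ?_ ?_ ?_
  · exact fun k => ((hasDerivAt_S hμ _).comp_add_const k 1).add
      ((hasDerivAt_S hμ _).comp_add_const k (-1))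
  · exact fun k => ((hasDerivAt_S_deriv hμ _).comp_add_const k 1).add
      ((hasDerivAt_S_deriv hμ _).comp_add_const k (-1))
  · have := continuous_S μ
    refine (Continuous.div (by fun_prop) (by fun_prop) fun k => ?_).add
      (Continuous.div (by fun_prop) (by fun_prop) fun k => ?_)
    · exact (pow_pos (S_pos hμ _) 3).ne'
    · exact (pow_pos (S_pos hμ _) 3).ne'
  · intro k
    have h1 := S_le hμ (k + 1)
    have h2 := S_le hμ (k + -1)
    have h3 := abs_add_le k 1
    have h4 := abs_add_le k (-1)
    rw [abs_neg, abs_one] at h4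
    rw [abs_one] at h3
    have h5 : |k| ≤ 1 + k ^ 2 := by nlinarith [sq_nonneg (|k| - 1), sq_abs k]
    unfold K
    rw [abs_of_pos (add_pos (S_pos hμ _) (S_pos hμ _))]
    nlinarith [hsq k, sq_nonneg k, mul_nonneg hμ.le (sq_nonneg k), mul_nonneg hμ'.le (sq_nonneg k)]
  · intro k
    refine (abs_add_le _ _).trans ?_
    nlinarith [b1 (k + 1), b1 (k + -1), mul_nonneg hμ.le (sq_nonneg k),
      mul_nonneg hμ'.le (sq_nonneg k), sq_nonneg k]
  · intro k
    refine (abs_add_le _ _).trans ?_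
    nlinarith [b2 (k + 1), b2 (k + -1), mul_nonneg hμ.le (sq_nonneg k),
      mul_nonneg hμ'.le (sq_nonneg k), sq_nonneg k]

lemma f_eq (m c x : ℝ) :
    f m c x = ((1 / (2 * m * c) : ℝ) : ℂ) * multiplier (K (m * c)) hC x := by
  have : (fun k : ℝ => √((k + 1) ^ 2 + m ^ 2 * c ^ 2) + √((k - 1) ^ 2 + m ^ 2 * c ^ 2)) =
      K (m * c) := by
    funext k
    simp only [K, S, mul_pow, sub_eq_add_neg]
  rw [f, this]
  rfl

lemma contDiff_f {m c : ℝ} (hm : 0 < m) (hc : 0 < c) : ContDiff ℝ (⊤ : ℕ∞) (f m c) := by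
  rw [funext (f_eq m c)]
  exact contDiff_const.mul (contDiff_multiplier (polyBounded_K (mul_pos hm hc)))

lemma f_neg (m c x : ℝ) : f m c (-x) = f m c x := by
  rw [f_eq, f_eq, multiplier_neg (K_neg _)]

/-! ### The eigenvalue identity and the regularized potential. -/

/-- The symbol `√(1 + μ²) (S₊ + S₋) - (S₊ S₋ + k² + 1 + μ²)`, written so that its limit `-k²` as
`μ → ∞` is visible. -/
def remainderSymbol (μ k : ℝ) : ℝ :=
  (S μ (k + 1) - √(1 + μ ^ 2)) * (S μ (k + -1) - √(1 + μ ^ 2))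

lemma polyBounded_remainderSymbol {μ : ℝ} (hμ : 0 < μ) : PolyBounded (remainderSymbol μ) :=
  (((polyBounded_S hμ).comp_add_const 1).sub (polyBounded_const _)).mul
    (((polyBounded_S hμ).comp_add_const (-1)).sub (polyBounded_const _))

/-- The function which converges to `h''`. -/
def G (μ x : ℝ) : ℂ := iteratedDeriv 2 hC x - multiplier (remainderSymbol μ) hC x

lemma continuous_G {μ : ℝ} (hμ : 0 < μ) : Continuous (G μ) :=
  (contDiff_hC.continuous_iteratedDeriv 2 (by norm_cast)).sub
    (contDiff_multiplier (polyBounded_remainderSymbol hμ)).continuous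

/-- The even part of the two shifted symbols recombines with the exponentials to `sin`, the odd part
`±2k` to `cos`. The term with `√(1 + μ²) - μ` cancels the eigenvalue in the potential. -/
lemma multiplier_u {m c : ℝ} (hm : 0 < m) (hc : 0 < c) (x : ℝ) :
    multiplier (fun k => √(k ^ 2 + m ^ 2 * c ^ 2) - m * c) (u m c) x =
      ((1 / (2 * m * c) : ℝ) : ℂ) *
        (Real.sin x * ((√(1 + (m * c) ^ 2) - m * c : ℝ) * multiplier (K (m * c)) hC x -
          G (m * c) x) - 2 * Real.cos x * deriv hC x) := by
  set μ := m * c with hμdef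
  have hμ : 0 < μ := mul_pos hm hc
  have hQ : (fun k : ℝ => √(k ^ 2 + m ^ 2 * c ^ 2) - μ) = fun k => S μ k - μ := by
    funext k
    simp only [S, hμdef, mul_pow]
  have hu : u m c = fun y => ((1 / (2 * m * c) : ℝ) : ℂ) *
      (multiplier (K μ) hC y * (Real.sin y : ℂ)) := by
    funext y
    rw [u, f_eq, mul_assoc]
  have hQp : PolyBounded fun k => S μ k - μ := (polyBounded_S hμ).sub (polyBounded_const μ)
  rw [hQ, hu, multiplier_const_mul_right, multiplier_mul_sin (polyBounded_K hμ) hQp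
    (fourier_multiplier_K hμ).1 (fourier_multiplier_K hμ).2]
  congr 1
  set M := √(1 + μ ^ 2) with hM
  have hM2 : M ^ 2 = 1 + μ ^ 2 := Real.sq_sqrt (by positivity)
  have hbase : PolyBounded fun k => ((M - μ) * K μ k + remainderSymbol μ k) + k ^ 2 :=
    (((polyBounded_const (M - μ)).mul (polyBounded_K hμ)).add
      (polyBounded_remainderSymbol hμ)).add (polyBounded_id.pow 2)
  have hcalc : ∀ s : ℝ, s = 1 ∨ s = -1 →
      multiplier (fun k => (S μ (k + s) - μ) * K μ k) hC x =
        ((M - μ : ℝ) * multiplier (K μ) hC x - G μ x) +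
          (2 * s : ℝ) * (-Complex.I * deriv hC x) := by
    intro s hs
    -- Here `S± K = S±² + S₊ S₋`, the square is polynomial, and `S₊ S₋ = (S₊ - M)(S₋ - M) + M K -
    -- M²`.
    have e : (fun k => (S μ (k + s) - μ) * K μ k) = fun k =>
        (((M - μ) * K μ k + remainderSymbol μ k) + k ^ 2) + (2 * s) * k := by
      funext k
      have h1 := S_sq μ (k + 1)
      have h2 := S_sq μ (k + -1)
      unfold K remainderSymbol
      rcases hs with rfl | rfl
      · linear_combination h1 - hM2
      · linear_combination h2 - hM2
    rw [e, multiplier_add hbase ((polyBounded_const (2 * s)).mul polyBounded_id),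
      multiplier_add (((polyBounded_const (M - μ)).mul (polyBounded_K hμ)).add
        (polyBounded_remainderSymbol hμ)) (polyBounded_id.pow 2),
      multiplier_add ((polyBounded_const (M - μ)).mul (polyBounded_K hμ))
        (polyBounded_remainderSymbol hμ), multiplier_const_mul, multiplier_const_mul,
      multiplier_id, multiplier_sq, G]
    ring
  rw [hcalc 1 (Or.inl rfl), hcalc (-1) (Or.inr rfl), sin_eq_exp]
  have hcos : (Real.cos x : ℂ) = 2⁻¹ *
      (Complex.exp ((1 : ℝ) * x * Complex.I) + Complex.exp ((-1 : ℝ) * x * Complex.I)) := by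
    rw [Complex.ofReal_cos, Complex.cos]
    push_cast
    ring_nf
  rw [hcos]
  have hI := Complex.I_ne_zero
  push_cast
  field_simp
  ring

/-- Since `g' = 4 sin²`, `h'` vanishes doubly at the zeros of `sin`; this lets `h' cos / sin` extend
across them. -/
lemma deriv_hC (x : ℝ) :
    deriv hC x = ((-8 * g x * Real.sin x ^ 2 * h x ^ 2 : ℝ) : ℂ) := by
  have h1 := (hasDerivAt_h x).ofReal_comp
  have : deriv hC x = _ := h1.deriv
  rw [this, Real.cos_two_mul, Real.cos_sq']
  congr 1
  ring

/-- The potential, with the zeros of the sine cancelled. -/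
def regularPotential (m c x : ℝ) : ℂ :=
  (1 / (2 * m) : ℝ) * ((G (m * c) x - (16 * g x * Real.sin x * Real.cos x * h x ^ 2 : ℝ)) / f m c x)

lemma potentialQuotient_eq {m c : ℝ} (hm : 0 < m) (hc : 0 < c) {x : ℝ} (hx : u m c x ≠ 0) :
    potentialQuotient m c x = regularPotential m c x := by
  have h1 : f m c x ≠ 0 := left_ne_zero_of_mul hx
  have h2 : (Real.sin x : ℂ) ≠ 0 := right_ne_zero_of_mul hx
  rw [Complex.ofReal_sin] at h2
  have hmC : (m : ℂ) ≠ 0 := by exact_mod_cast hm.ne'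
  have hcC : (c : ℂ) ≠ 0 := by exact_mod_cast hc.ne'
  rw [potentialQuotient, multiplier_u hm hc, regularPotential, deriv_hC, eigenvalue, u]
  have h3 : multiplier (K (m * c)) hC x = 2 * m * c * f m c x := by
    rw [f_eq]
    push_cast
    field_simp
  rw [h3, ← mul_pow]
  push_cast
  field_simp
  ring

lemma eventually_u_ne_zero {m c : ℝ} (hm : 0 < m) (hc : 0 < c) {x : ℝ} (hx : f m c x ≠ 0) :
    ∀ᶠ r in 𝓝[≠] x, u m c r ≠ 0 := by
  have h1 : ∀ᶠ r in 𝓝[≠] x, f m c r ≠ 0 :=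
    ((contDiff_f hm hc).continuous.continuousAt.eventually_ne hx).filter_mono nhdsWithin_le_nhds
  have h2 : ∀ᶠ r in 𝓝[≠] x, Real.sin r ≠ 0 := by
    by_cases hs : Real.sin x = 0
    · refine (Real.hasDerivAt_sin x).eventually_ne fun hcos => ?_
      have := Real.sin_sq_add_cos_sq x
      rw [hs, hcos] at this
      norm_num at this
    · exact (Real.continuous_sin.continuousAt.eventually_ne hs).filter_mono nhdsWithin_le_nhds
  filter_upwards [h1, h2] with r h3 h4
  exact mul_ne_zero h3 (by exact_mod_cast h4)

lemma continuous_g : Continuous g :=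
  continuous_iff_continuousAt.2 fun y => (hasDerivAt_g y).continuousAt

lemma continuous_h : Continuous h :=
  continuous_iff_continuousAt.2 fun y => (hasDerivAt_h y).continuousAt

lemma continuousAt_regularPotential {m c : ℝ} (hm : 0 < m) (hc : 0 < c) {x : ℝ}
    (hx : f m c x ≠ 0) : ContinuousAt (regularPotential m c) x := by
  have h1 := continuous_G (mul_pos hm hc)
  have h2 := (contDiff_f hm hc).continuous
  have h3 := continuous_g
  have h4 := continuous_h
  exact continuousAt_const.mul
    ((by fun_prop : Continuous fun x =>
      (G (m * c) x - (16 * g x * Real.sin x * Real.cos x * h x ^ 2 : ℝ))).continuousAt.div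
      h2.continuousAt hx)

lemma tendsto_potentialQuotient {m c : ℝ} (hm : 0 < m) (hc : 0 < c) {x : ℝ} (hx : f m c x ≠ 0) :
    Tendsto (potentialQuotient m c) (𝓝[≠] x) (𝓝 (regularPotential m c x)) := by
  refine ((continuousAt_regularPotential hm hc hx).tendsto.mono_left nhdsWithin_le_nhds).congr' ?_
  filter_upwards [eventually_u_ne_zero hm hc hx] with r hr
  exact (potentialQuotient_eq hm hc hr).symm

lemma V_eq {m c : ℝ} (hm : 0 < m) (hc : 0 < c) {x : ℝ} (hx : f m c x ≠ 0) :
    V m c x = regularPotential m c x := by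
  unfold V
  split_ifs with hu
  · exact potentialQuotient_eq hm hc hu
  · exact (tendsto_potentialQuotient hm hc hx).limUnder_eq

/-! ### Symbol estimates and the limit of the potential and eigenvalue. -/

/-- Rationalizing, `(S - M)(S + M) = k² + 2ks` because `s² = 1`, and `S + M ≥ μ`. The remainder
symbol is a product of two such differences, hence `O(μ⁻²)`. -/
lemma abs_S_sub_le {μ : ℝ} (hμ : 0 < μ) {s : ℝ} (hs : |s| = 1) (k : ℝ) :
    |S μ (k + s) - √(1 + μ ^ 2)| ≤ 1 / μ * (1 + |k|) ^ 2 := by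
  set M := √(1 + μ ^ 2) with hM
  have hM2 : M ^ 2 = 1 + μ ^ 2 := Real.sq_sqrt (by positivity)
  have hM0 : 0 ≤ M := Real.sqrt_nonneg _
  have h1 := le_S (μ := μ) (k + s)
  have h2 := S_sq μ (k + s)
  have hs2 : s ^ 2 = 1 := by rw [← sq_abs, hs, one_pow]
  have h3 : (S μ (k + s) - M) * (S μ (k + s) + M) = k ^ 2 + 2 * (k * s) := by
    linear_combination h2 - hM2 + hs2
  have h4 : |k ^ 2 + 2 * (k * s)| ≤ (1 + |k|) ^ 2 := by
    have h5 : |k * s| = |k| := by rw [abs_mul, hs, mul_one]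
    have := abs_add_le (k ^ 2) (2 * (k * s))
    rw [abs_mul, h5, abs_two, abs_of_nonneg (sq_nonneg k)] at this
    nlinarith [sq_abs k]
  rw [← h3, abs_mul, abs_of_pos (by linarith : 0 < S μ (k + s) + M)] at h4
  rw [one_div_mul_eq_div, le_div_iff₀ hμ]
  refine le_trans ?_ h4
  gcongr
  linarith

lemma abs_remainderSymbol_le {μ : ℝ} (hμ : 0 < μ) (k : ℝ) :
    |remainderSymbol μ k| ≤ 1 / μ ^ 2 * (1 + |k|) ^ 4 := by
  rw [remainderSymbol, abs_mul]
  calc _ ≤ (1 / μ * (1 + |k|) ^ 2) * (1 / μ * (1 + |k|) ^ 2) :=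
        mul_le_mul (abs_S_sub_le hμ (by simp) k) (abs_S_sub_le hμ (by simp) k) (abs_nonneg _)
          (by positivity)
    _ = 1 / μ ^ 2 * (1 + |k|) ^ 4 := by ring

lemma abs_K_sub_le {μ : ℝ} (hμ : 0 < μ) (k : ℝ) :
    |1 / (2 * μ) * K μ k - 1| ≤ 1 / μ ^ 2 * (1 + |k|) ^ 2 := by
  have hS : ∀ s : ℝ, |s| = 1 → |S μ (k + s) - μ| ≤ 1 / μ * (1 + |k|) ^ 2 := by
    intro s hs
    have h1 := le_S (μ := μ) (k + s)
    have h2 := S_sq μ (k + s)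
    have h3 := abs_add_le k s
    rw [hs] at h3
    rw [abs_of_nonneg (by linarith), one_div_mul_eq_div, le_div_iff₀ hμ]
    calc (S μ (k + s) - μ) * μ ≤ (S μ (k + s) - μ) * (S μ (k + s) + μ) := by
          gcongr
          linarith
      _ = |k + s| ^ 2 := by rw [sq_abs]; linear_combination h2
      _ ≤ (1 + |k|) ^ 2 := by gcongr; linarith
  have e : 1 / (2 * μ) * K μ k - 1 =
      1 / (2 * μ) * ((S μ (k + 1) - μ) + (S μ (k + -1) - μ)) := by
    unfold K
    field_simp
    ring
  rw [e, abs_mul, abs_of_pos (by positivity)]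
  calc _ ≤ 1 / (2 * μ) * (1 / μ * (1 + |k|) ^ 2 + 1 / μ * (1 + |k|) ^ 2) := by
        gcongr
        exact (abs_add_le _ _).trans (add_le_add (hS 1 (by simp)) (hS (-1) (by simp)))
    _ = 1 / μ ^ 2 * (1 + |k|) ^ 2 := by field_simp; ring

/-- `f_c - h` is small, with its derivatives of order at most two. -/
lemma exists_iteratedDeriv_f_sub_le : ∃ C, 0 ≤ C ∧ ∀ m c : ℝ, 0 < m → 0 < c → ∀ j ≤ 2, ∀ x,
    ‖iteratedDeriv j (fun y => f m c y - hC y) x‖ ≤ C * (1 / (m * c) ^ 2) := by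
  -- Two powers come from the estimate on `K`, two from the factor `k^j` of the derivatives.
  obtain ⟨C, hC0, hb⟩ := exists_multiplier_bound 4
  refine ⟨C, hC0, fun m c hm hc j hj x => ?_⟩
  have hμ := mul_pos hm hc
  have hP : PolyBounded fun k => 1 / (2 * (m * c)) * K (m * c) k - 1 :=
    ((polyBounded_const _).mul (polyBounded_K hμ)).sub (polyBounded_const 1)
  have e : (fun y => f m c y - hC y) =
      multiplier (fun k => 1 / (2 * (m * c)) * K (m * c) k - 1) hC := by
    funext y
    rw [multiplier_sub ((polyBounded_const _).mul (polyBounded_K hμ)) (polyBounded_const 1),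
      multiplier_const_mul, multiplier_one, f_eq, mul_assoc]
  rw [e, iteratedDeriv_multiplier hP, norm_mul, norm_pow, Complex.norm_I, one_pow, one_mul]
  refine hb _ _ (fun k => ?_) x
  rw [abs_mul, abs_pow]
  have h1 : (1 : ℝ) ≤ 1 + |k| := by linarith [abs_nonneg k]
  calc |k| ^ j * |1 / (2 * (m * c)) * K (m * c) k - 1|
      ≤ (1 + |k|) ^ 2 * (1 / (m * c) ^ 2 * (1 + |k|) ^ 2) := by
        gcongr
        · exact (pow_le_pow_left₀ (abs_nonneg k) (by linarith) j).trans
            (pow_le_pow_right₀ h1 hj)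
        · exact abs_K_sub_le hμ k
    _ = 1 / (m * c) ^ 2 * (1 + |k|) ^ 4 := by ring

lemma tendsto_const_mul_inv_sq {m : ℝ} (hm : 0 < m) (C : ℝ) :
    Tendsto (fun c : ℝ => C * (1 / (m * c) ^ 2)) atTop (𝓝 0) := by
  have h1 : Tendsto (fun c : ℝ => (m * c) ^ 2) atTop atTop :=
    (tendsto_pow_atTop two_ne_zero).comp (tendsto_id.const_mul_atTop hm)
  simpa using h1.inv_tendsto_atTop.const_mul C

lemma tendsto_f {m : ℝ} (hm : 0 < m) (x : ℝ) :
    Tendsto (fun c => f m c x) atTop (𝓝 (hC x)) := by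
  obtain ⟨C, -, hb⟩ := exists_iteratedDeriv_f_sub_le
  rw [tendsto_iff_norm_sub_tendsto_zero]
  refine squeeze_zero' (Eventually.of_forall fun c => norm_nonneg _) ?_
    (tendsto_const_mul_inv_sq hm C)
  filter_upwards [eventually_gt_atTop 0] with c hc
  simpa using hb m c hm hc 0 (by norm_num) x

lemma tendsto_G {m : ℝ} (hm : 0 < m) (x : ℝ) :
    Tendsto (fun c => G (m * c) x) atTop (𝓝 (iteratedDeriv 2 hC x)) := by
  obtain ⟨C, -, hb⟩ := exists_multiplier_bound 4
  rw [tendsto_iff_norm_sub_tendsto_zero]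
  refine squeeze_zero' (Eventually.of_forall fun c => norm_nonneg _) ?_
    (tendsto_const_mul_inv_sq hm C)
  filter_upwards [eventually_gt_atTop 0] with c hc
  have := hb _ _ (abs_remainderSymbol_le (mul_pos hm hc)) x
  simpa [G] using this

lemma iteratedDeriv_two_h (x : ℝ) : iteratedDeriv 2 h x =
    -8 * ((4 * Real.sin x ^ 4 + 2 * g x * Real.sin x * Real.cos x) * h x ^ 2 -
      16 * g x ^ 2 * Real.sin x ^ 4 * h x ^ 3) := by
  have hd : ∀ x, HasDerivAt h (-8 * (g x * Real.sin x ^ 2 * h x ^ 2)) x := fun x =>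
    (hasDerivAt_h x).congr_deriv (by rw [Real.cos_two_mul, Real.cos_sq']; ring)
  rw [iteratedDeriv_succ, iteratedDeriv_one, funext fun x => (hd x).deriv]
  have h1 := (((hasDerivAt_g x).mul ((Real.hasDerivAt_sin x).pow 2)).mul ((hd x).pow 2)).const_mul
    (-8)
  refine h1.deriv.trans ?_
  rw [Real.cos_two_mul, Real.cos_sq']
  simp
  ring

lemma regularPotential_limit (m : ℝ) (x : EuclideanSpace ℝ (Fin 3)) :
    ((1 / (2 * m) : ℝ) : ℂ) * ((iteratedDeriv 2 hC ‖x‖ -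
      (16 * g ‖x‖ * Real.sin ‖x‖ * Real.cos ‖x‖ * h ‖x‖ ^ 2 : ℝ)) / hC ‖x‖) =
      ((VNW x / (2 * m) : ℝ) : ℂ) := by
  have key : (iteratedDeriv 2 h ‖x‖ - 16 * g ‖x‖ * Real.sin ‖x‖ * Real.cos ‖x‖ * h ‖x‖ ^ 2) /
      h ‖x‖ =
      VNW x := by
    rw [div_eq_iff (h_pos _).ne', iteratedDeriv_two_h, VNW]
    have : 1 + g ‖x‖ ^ 2 ≠ 0 := by positivity
    unfold h
    field_simp
    ring
  rw [iteratedDeriv_hC, hC, ← key]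
  push_cast
  ring

lemma tendsto_W {m : ℝ} (hm : 0 < m) (x : EuclideanSpace ℝ (Fin 3)) :
    Tendsto (fun c : ℝ => W m c x) atTop (𝓝 ((VNW x / (2 * m) : ℝ) : ℂ)) := by
  have h0 : hC ‖x‖ ≠ 0 := by
    have := (h_pos ‖x‖).ne'
    simpa [hC] using this
  rw [← regularPotential_limit]
  have h1 := (((tendsto_G hm ‖x‖).sub_const
    ((16 * g ‖x‖ * Real.sin ‖x‖ * Real.cos ‖x‖ * h ‖x‖ ^ 2 : ℝ) : ℂ)).div (tendsto_f hm ‖x‖)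
      h0).const_mul ((1 / (2 * m) : ℝ) : ℂ)
  refine h1.congr' ?_
  filter_upwards [(tendsto_f hm ‖x‖).eventually_ne h0, eventually_gt_atTop 0] with c hf hc
  exact (V_eq hm hc hf).symm

lemma eventually_potential {m : ℝ} (hm : 0 < m) (x : EuclideanSpace ℝ (Fin 3)) :
    ∀ᶠ c : ℝ in atTop, (∀ᶠ r : ℝ in 𝓝[≠] ‖x‖, u m c r ≠ 0) ∧
      Tendsto (potentialQuotient m c) (𝓝[≠] ‖x‖) (𝓝 (W m c x)) := by
  have h0 : hC ‖x‖ ≠ 0 := by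
    have := (h_pos ‖x‖).ne'
    simpa [hC] using this
  filter_upwards [(tendsto_f hm ‖x‖).eventually_ne h0, eventually_gt_atTop 0] with c hf hc
  refine ⟨eventually_u_ne_zero hm hc hf, ?_⟩
  rw [W, V_eq hm hc hf]
  exact tendsto_potentialQuotient hm hc hf

/-- Rationalization gives `λ_c = 1 / (√(1/c² + m²) + m)`. -/
lemma tendsto_eigenvalue {m : ℝ} (hm : 0 < m) :
    Tendsto (fun c : ℝ => eigenvalue m c) atTop (𝓝 (1 / (2 * m))) := by
  have h1 : Tendsto (fun c : ℝ => √(1 / c ^ 2 + m ^ 2) + m) atTop (𝓝 (2 * m)) := by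
    have h2 : Tendsto (fun c : ℝ => 1 / c ^ 2) atTop (𝓝 0) := by
      simpa using tendsto_const_mul_inv_sq one_pos 1
    have h3 := ((h2.add_const (m ^ 2)).sqrt).add_const m
    rw [zero_add, Real.sqrt_sq hm.le] at h3
    convert h3 using 2
    ring
  have h4 := h1.inv₀ (by positivity)
  rw [← one_div] at h4
  refine h4.congr' ?_
  filter_upwards [eventually_gt_atTop 0] with c hc
  have h5 : √(1 / c ^ 2 + m ^ 2) = √(1 + m ^ 2 * c ^ 2) / c := by
    rw [← Real.sqrt_sq hc.le, ← Real.sqrt_div (by positivity), Real.sqrt_sq hc.le]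
    congr 1
    field_simp
  have h6 : √(1 + m ^ 2 * c ^ 2) ^ 2 = 1 + m ^ 2 * c ^ 2 := Real.sq_sqrt (by positivity)
  rw [h5, eigenvalue]
  refine inv_eq_of_mul_eq_one_left ?_
  generalize √(1 + m ^ 2 * c ^ 2) = s at h6
  field_simp
  linear_combination h6

/-! ### The function `sinc` and convergence in `C²(ℝ³)`. -/

/-- The function `sinc`, with complex values. -/
def sincC (x : ℝ) : ℂ := Real.sinc x

lemma hasDerivAt_cos_shift (n : ℕ) (x : ℝ) :
    HasDerivAt (fun x : ℝ => (Real.cos (x + n * (Real.pi / 2)) : ℂ))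
      (Real.cos (x + (n + 1 : ℕ) * (Real.pi / 2)) : ℂ) x := by
  have h1 := ((Real.hasDerivAt_cos (x + n * (Real.pi / 2))).comp_add_const x _).ofReal_comp
  refine h1.congr_deriv ?_
  rw [← Real.cos_add_pi_div_two]
  congr 2
  push_cast
  ring

lemma continuous_cos_shift (n : ℕ) :
    Continuous fun x : ℝ => (Real.cos (x + n * (Real.pi / 2)) : ℂ) := by fun_prop

/-- From `sinc r = ∫₀¹ cos(t r) dt`; each derivative shifts the phase by `π/2` and adds a factor
`t`. This shows smoothness at 0 and bounds all derivatives by 1. -/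
lemma iteratedDeriv_sincC (n : ℕ) : iteratedDeriv n sincC = fun r => ∫ t in (0 : ℝ)..1,
    (t : ℂ) ^ n * (Real.cos (t * r + n * (Real.pi / 2)) : ℂ) := by
  induction n with
  | zero =>
    funext r
    have h1 := eq_mul_integral_deriv (Φ := fun x => (Real.sin x : ℂ))
      (Φ' := fun x => (Real.cos x : ℂ)) (fun x => (Real.hasDerivAt_sin x).ofReal_comp)
      (by fun_prop) (by simp) r
    simp only [iteratedDeriv_zero, pow_zero, one_mul, Nat.cast_zero, zero_mul, add_zero]
    rcases eq_or_ne r 0 with rfl | hr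
    · simp [sincC]
    · rw [sincC, Real.sinc_of_ne_zero hr, Complex.ofReal_div, h1,
        mul_div_cancel_left₀ _ (by exact_mod_cast hr)]
  | succ n ih =>
    rw [iteratedDeriv_succ, ih]
    funext r
    exact (hasDerivAt_integral_dilation n (hasDerivAt_cos_shift n)
      (continuous_cos_shift (n + 1)) r).deriv

lemma contDiff_sincC : ContDiff ℝ (⊤ : ℕ∞) sincC := by
  refine contDiff_of_differentiable_iteratedDeriv fun n _ => ?_
  rw [iteratedDeriv_sincC]
  exact fun r => (hasDerivAt_integral_dilation n (hasDerivAt_cos_shift n)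
      (continuous_cos_shift (n + 1)) r).differentiableAt

lemma norm_iteratedDeriv_sincC_le (n : ℕ) (r : ℝ) : ‖iteratedDeriv n sincC r‖ ≤ 1 := by
  rw [iteratedDeriv_sincC]
  have := intervalIntegral.norm_integral_le_of_norm_le_const (a := 0) (b := 1) (C := 1)
    (f := fun t : ℝ => (t : ℂ) ^ n * (Real.cos (t * r + n * (Real.pi / 2)) : ℂ)) fun t ht => by
      rw [Set.uIoc_of_le zero_le_one] at ht
      rw [norm_mul, norm_pow, Complex.norm_real, Complex.norm_real, Real.norm_of_nonneg ht.1.le]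
      exact mul_le_one₀ (pow_le_one₀ ht.1.le ht.2) (norm_nonneg _) (Real.abs_cos_le_one _)
  simpa using this

/-- Multiplication by `sinc / √(4π)`. -/
def radialProfile (φ : ℝ → ℂ) (r : ℝ) : ℂ := φ r * ((√(4 * Real.pi) : ℂ)⁻¹ * sincC r)

lemma contDiff_radialProfile {φ : ℝ → ℂ} (hφ : ContDiff ℝ (⊤ : ℕ∞) φ) :
    ContDiff ℝ 4 (radialProfile φ) :=
  (hφ.mul (contDiff_const.mul contDiff_sincC)).of_le (by norm_cast)

lemma radialProfile_neg {φ : ℝ → ℂ} (hφ : ∀ r, φ (-r) = φ r) (r : ℝ) :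
    radialProfile φ (-r) = radialProfile φ r := by
  simp only [radialProfile, hφ, sincC, Real.sinc_neg]

lemma norm_iteratedDeriv_radialProfile_le {φ : ℝ → ℂ} (hφ : ContDiff ℝ (⊤ : ℕ∞) φ) {ε : ℝ}
    (hε : ∀ i ≤ 2, ∀ r, ‖iteratedDeriv i φ r‖ ≤ ε) {i : ℕ} (hi : i ≤ 2) (r : ℝ) :
    ‖iteratedDeriv i (radialProfile φ) r‖ ≤ 4 * ε := by
  have hε0 : 0 ≤ ε := (norm_nonneg _).trans (hε 0 (by norm_num) 0)
  have hq : ‖(√(4 * Real.pi) : ℂ)⁻¹‖ ≤ 1 := by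
    rw [norm_inv, Complex.norm_real, Real.norm_of_nonneg (Real.sqrt_nonneg _)]
    refine inv_le_one_of_one_le₀ (Real.one_le_sqrt.2 ?_)
    linarith [Real.pi_gt_three]
  have hs : ∀ n, ‖iteratedDeriv n (fun r => (√(4 * Real.pi) : ℂ)⁻¹ * sincC r) r‖ ≤ 1 := fun n => by
    rw [iteratedDeriv_const_mul_field, norm_mul]
    exact mul_le_one₀ hq (norm_nonneg _) (norm_iteratedDeriv_sincC_le n r)
  have h1 := norm_iteratedFDeriv_mul_le (N := (⊤ : ℕ∞)) hφ
    ((contDiff_const (c := (√(4 * Real.pi) : ℂ)⁻¹)).mul contDiff_sincC) r (n := i)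
    (by exact_mod_cast le_top)
  simp only [norm_iteratedFDeriv_eq_norm_iteratedDeriv] at h1
  refine h1.trans ?_
  calc _ ≤ ∑ j ∈ Finset.range (i + 1), (i.choose j : ℝ) * ε := by
        refine Finset.sum_le_sum fun j hj => ?_
        rw [mul_assoc]
        refine mul_le_mul_of_nonneg_left ?_ (by positivity)
        have := hε j (by simp only [Finset.mem_range] at hj; omega) r
        simpa using mul_le_mul this (hs (i - j)) (norm_nonneg _) hε0
    _ = 2 ^ i * ε := by
        rw [← Finset.sum_mul]
        congr 1
        exact_mod_cast Nat.sum_range_choose i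
    _ ≤ 2 ^ 2 * ε := by gcongr; norm_num
    _ = 4 * ε := by norm_num

lemma hasDerivAt_u_zero {m c : ℝ} (hm : 0 < m) (hc : 0 < c) :
    HasDerivAt (u m c) (f m c 0) 0 := by
  have h1 := (((contDiff_f hm hc).differentiable (by simp)) 0).hasDerivAt
  have h2 := h1.mul (Real.hasDerivAt_sin 0).ofReal_comp
  refine h2.congr_deriv ?_
  simp

lemma v_eq {m c : ℝ} (hm : 0 < m) (hc : 0 < c) :
    v m c = fun x => radialProfile (f m c) ‖x‖ := by
  funext x
  unfold v radialProfile
  split_ifs with hx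
  · rw [(hasDerivAt_u_zero hm hc).deriv, hx]
    simp [sincC, div_eq_mul_inv]
  · have hx' : ‖x‖ ≠ 0 := norm_ne_zero_iff.2 hx
    rw [u, sincC, Real.sinc_of_ne_zero hx']
    push_cast
    ring

lemma uNW_eq : (fun x => ((uNW x / √(4 * Real.pi) : ℝ) : ℂ)) =
    fun x => radialProfile hC ‖x‖ := by
  funext x
  simp only [uNW, radialProfile, hC, h, sincC]
  push_cast
  ring

lemma hC_neg (x : ℝ) : hC (-x) = hC x := by simp only [hC, h_neg]

lemma tendstoUniformlyC2_v {m : ℝ} (hm : 0 < m) :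
    TendstoUniformlyC2 (v m) (fun x => ((uNW x / √(4 * Real.pi) : ℝ) : ℂ)) := by
  have hv : ∀ c : ℝ, 0 < c → ContDiff ℝ 2 (v m c) := fun c hc => by
    rw [v_eq hm hc]
    exact contDiff_two_comp_norm_of_even (contDiff_radialProfile (contDiff_f hm hc))
      (radialProfile_neg (f_neg m c))
  have hNW : ContDiff ℝ 2 (fun x => ((uNW x / √(4 * Real.pi) : ℝ) : ℂ)) := by
    rw [uNW_eq]
    exact contDiff_two_comp_norm_of_even (contDiff_radialProfile contDiff_hC)
      (radialProfile_neg hC_neg)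
  refine ⟨hv, hNW, fun j hj => ?_⟩
  obtain ⟨C, hC0, hb⟩ := exists_iteratedDeriv_f_sub_le
  rw [Metric.tendstoUniformly_iff]
  intro ε hε
  -- The factor 3 is the loss from the line to radial functions; 4 is the Leibniz loss `2²` in
  -- multiplying by `sinc / √(4π)`.
  have h1 := (tendsto_const_mul_inv_sq hm (3 * (4 * C))).eventually_lt_const hε
  filter_upwards [h1, eventually_gt_atTop 0] with c h2 hc x
  have h3 : iteratedFDeriv ℝ j (v m c) x -
      iteratedFDeriv ℝ j (fun x => ((uNW x / √(4 * Real.pi) : ℝ) : ℂ)) x =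
      iteratedFDeriv ℝ j (fun x : EuclideanSpace ℝ (Fin 3) =>
        radialProfile (fun r => f m c r - hC r) ‖x‖) x := by
    have hj' : (j : WithTop ℕ∞) ≤ 2 := by exact_mod_cast hj
    rw [← iteratedFDeriv_sub_apply ((hv c hc).of_le hj').contDiffAt (hNW.of_le hj').contDiffAt]
    congr 1
    rw [v_eq hm hc, uNW_eq]
    funext y
    simp only [Pi.sub_apply, radialProfile]
    ring
  have hD : ContDiff ℝ (⊤ : ℕ∞) (fun r => f m c r - hC r) := (contDiff_f hm hc).sub contDiff_hC
  rw [dist_comm, dist_eq_norm, h3]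
  refine lt_of_le_of_lt ?_ h2
  have h4 := norm_iteratedFDeriv_comp_norm_le_of_even (contDiff_radialProfile hD)
    (radialProfile_neg fun r => by rw [f_neg, hC_neg])
    (fun i hi r => norm_iteratedDeriv_radialProfile_le hD
      (fun i hi r => hb m c hm hc i hi r) hi r) hj x
  exact h4.trans (by linarith)

end NeumannWigner

end

theorem mainTheorem7 (m : ℝ) (hm : 0 < m) :
    Tendsto (fun c : ℝ => NeumannWigner.eigenvalue m c) atTop (𝓝 (1 / (2 * m))) ∧
    NeumannWigner.TendstoUniformlyC2 (NeumannWigner.v m)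
      (fun x => ((NeumannWigner.uNW x / √(4 * Real.pi) : ℝ) : ℂ)) ∧
    ∀ x : EuclideanSpace ℝ (Fin 3),
      (∀ᶠ c : ℝ in atTop,
        (∀ᶠ r : ℝ in 𝓝[≠] ‖x‖, NeumannWigner.u m c r ≠ 0) ∧
        Tendsto (NeumannWigner.potentialQuotient m c) (𝓝[≠] ‖x‖)
          (𝓝 (NeumannWigner.W m c x))) ∧
      Tendsto (fun c : ℝ => NeumannWigner.W m c x) atTop
        (𝓝 ((NeumannWigner.VNW x / (2 * m) : ℝ) : ℂ)) :=
  ⟨NeumannWigner.tendsto_eigenvalue hm, NeumannWigner.tendstoUniformlyC2_v hm, fun x =>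
    ⟨NeumannWigner.eventually_potential hm x, NeumannWigner.tendsto_W hm x⟩⟩
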